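/- Let $\alpha\in(0,1)$. The Fourier transform is $\hat f(\xi)=\int_{\mathbb R} f(x)e^{-ix\xi}\,dx$ for Schwartz functions $f$, extended by duality to tempered distributions on $\mathbb R$. Let $K_\alpha$ be the tempered distribution with $$\widehat{K_\alpha}(\xi)=\left(\frac{\tanh \xi}{\xi}\right)^{\alpha}\quad(\xi\neq0),\qquad \widehat{K_\alpha}(0)=1 .$$ Then $K_\alpha$ is given by a real-valued function on $\mathbb R$, unique up to null sets, which (for a suitable representative) has the following properties. (i) $K_\alpha$ is of class $C^\infty$ on $\mathbb R\setminus\{0\}$, and for every real $N\ge 1$ there is a constant $C=C(\alpha,N)>0$ such that $|K_\alpha(x)|\le C x^{-N}$ for all $x>0$. (ii) $K_\alpha$ is bell-shaped: for every $p$ with $1\le p<1/(1-\alpha)$ it lies in the $L^p(\mathbb R)$-closure of the set of even, continuous, positive functions in $L^p(\mathbb R)$ that are decreasing on the positive half-axis. Moreover $K_\alpha$ is itself even, positive on $\mathbb R\setminus\{0\}$, and strictly decreasing on $(0,\infty)$; and it is strictly convex on each of $(0,\infty)$ and $(-\infty,0)$. (iii) $\|K_\alpha\|_{L^1}=\int_{\mathbb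 R}K_\alpha(x)\,dx=\widehat{K_\alpha}(0)=1$, and for every $1\le p\le\infty$ the convolution operator $f\mapsto K_\alpha * f$ on the real-valued functions in $L^p(\mathbb R)$ has operator norm $1$. (iv) For $0<p\le\infty$, $K_\alpha\in L^p(\mathbb R)$ if and only if $p<1/(1-\alpha)$. (In particular, $K_{1/4}\in L^p(\mathbb R)$ for all $0<p<4/3$.) -/

import Mathlib

open MeasureTheory Set
open scoped SchwartzMap ENNReal ContDiff

noncomputable section

/-- The symbol `(tanh ξ / ξ) ^ α`, with its continuous extension `1` at `ξ = 0`. -/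
def tanhSymbol (α ξ : ℝ) : ℝ :=
  if ξ = 0 then 1 else (Real.tanh ξ / ξ) ^ α

/-- Multiplication by `1 / (2π)` on the real line. -/
def frequencyScaling : ℝ ≃L[ℝ] ℝ :=
  ContinuousLinearEquiv.unitsEquivAut ℝ
    (Units.mk0 ((2 * Real.pi)⁻¹) (inv_ne_zero Real.two_pi_pos.ne'))

/-- The Fourier transform `φ ↦ (ξ ↦ ∫ φ(x) e^{-ixξ} dx)` on Schwartz functions, obtained from the
one of Mathlib (which has `e^{-2πixξ}`) by scaling the frequency;
see `angularFourierSchwartz_apply`. -/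
def angularFourierSchwartz : 𝓢(ℝ, ℂ) →L[ℂ] 𝓢(ℝ, ℂ) :=
  (SchwartzMap.compCLMOfContinuousLinearEquiv ℂ frequencyScaling).comp
    (FourierTransform.fourierCLM ℂ 𝓢(ℝ, ℂ))

theorem angularFourierSchwartz_apply (φ : 𝓢(ℝ, ℂ)) (ξ : ℝ) :
    angularFourierSchwartz φ ξ = ∫ x : ℝ, φ x * Complex.exp (-Complex.I * x * ξ) := by
  have h : angularFourierSchwartz φ ξ
      = FourierTransform.fourier (φ : ℝ → ℂ) (frequencyScaling ξ) := by
    rw [← SchwartzMap.fourier_coe]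
    rfl
  rw [h, Real.fourier_eq']
  refine integral_congr_ae (Filter.Eventually.of_forall fun x => ?_)
  have hs : frequencyScaling ξ = ξ * (2 * Real.pi)⁻¹ := rfl
  have hpi : (Real.pi : ℂ) ≠ 0 := by exact_mod_cast Real.pi_ne_zero
  simp only [hs, smul_eq_mul]
  rw [mul_comm]
  congr 2
  simp
  field_simp

/-- The Fourier transform of tempered distributions, by duality: `(F T)(φ) = T (F φ)`. -/
def angularFourier (T : 𝓢'(ℝ, ℂ)) : 𝓢'(ℝ, ℂ) :=
  PointwiseConvergenceCLM.precomp ℂ angularFourierSchwartz T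

theorem angularFourier_apply (T : 𝓢'(ℝ, ℂ)) (φ : 𝓢(ℝ, ℂ)) :
    angularFourier T φ = T (angularFourierSchwartz φ) := rfl

/-- The tempered distribution `T` is the function `f`: `T φ = ∫ φ f`, with absolutely convergent
integrals, for all Schwartz functions `φ`. -/
def IsGivenBy (T : 𝓢'(ℝ, ℂ)) (f : ℝ → ℝ) : Prop :=
  ∀ φ : 𝓢(ℝ, ℂ), Integrable (fun x : ℝ => φ x * (f x : ℂ)) ∧
    T φ = ∫ x : ℝ, φ x * (f x : ℂ)

/-- The function `K`, as a tempered distribution, has Fourier transform `(tanh ξ / ξ) ^ α`. -/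
def IsTanhKernel (α : ℝ) (K : ℝ → ℝ) : Prop :=
  ∃ T : 𝓢'(ℝ, ℂ), IsGivenBy T K ∧ IsGivenBy (angularFourier T) (tanhSymbol α)

/-- Bell-shaped elements of `L^p(ℝ)`: those in the `L^p`-closure of the set of even, continuous and
positive functions that are decreasing on the positive half-axis. -/
def IsBellShaped (p : ℝ≥0∞) (f : ℝ → ℝ) : Prop :=
  MemLp f p ∧ ∀ ε : ℝ≥0∞, 0 < ε → ∃ g : ℝ → ℝ,
    MemLp g p ∧ Continuous g ∧ (∀ x, g (-x) = g x) ∧ (∀ x, 0 < g x) ∧ AntitoneOn g (Ici 0) ∧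
      eLpNorm (fun x => f x - g x) p < ε

/-- `C` bounds the operator `f ↦ K * f` on `L^p(ℝ)`. -/
def IsConvolutionBound (K : ℝ → ℝ) (p C : ℝ≥0∞) : Prop :=
  ∀ f : ℝ → ℝ, MemLp f p →
    eLpNorm (fun x : ℝ => ∫ y : ℝ, K (x - y) * f y) p ≤ C * eLpNorm f p

end

/-!
In the right half-plane `tanh z / z` avoids the negative half-axis, so its power `F z` with exponent
`α` is holomorphic there, and `F z = O(|z| ^ (-α))` away from the imaginary axis. On the imaginary
axis `tanh z / z` takes the real values `tan s / s`, and it approaches them from the lower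
half-plane, so the boundary values of `F` at `i s` have imaginary part `-π ρ(s)` with `ρ ≥ 0`.
Cauchy's theorem, applied to `(2 z F z - 2 ξ F ξ) / (z ^ 2 - ξ ^ 2)`, then yields the Stieltjes
representation `F ξ = ∫ 2 s / (s ^ 2 + ξ ^ 2) ρ(s) ds` over `s > 0`. As `2 s / (s ^ 2 + ξ ^ 2)` is
the Fourier transform of `e ^ (-s|x|)`, the kernel is the superposition
`K x = ∫ e ^ (-s|x|) ρ(s) ds` of exponentials. Positivity, evenness, strict monotonicity, strict
convexity and smoothness away from `0` are inherited from the exponentials.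

The integral of `s ^ (-β) ρ(s)` converges for every `β > 1 - α`, because `ρ` vanishes on `(0, π/2)`
and is bounded by `|cos s| ^ (-α) s ^ (-α)`. This gives `K x = O(x ^ (-β))` for all these `β`, hence
the decay and `K ∈ L^p` for `p < 1 / (1 - α)`. Conversely `F ξ ≤ 4 ∫ K` over `(0, 1/ξ)`, so that the
integral of `K` over `(0, x)` is at least a multiple of `x ^ α`, which Hölder's inequality excludes
for `K ∈ L^p` with `p ≥ 1 / (1 - α)`.
-/

noncomputable section

open Filter
open scoped Real Topology

section LaplaceKernel

theorem integral_lt_integral_of_ae_lt {Ω : Type*} [MeasurableSpace Ω] {μ : Measure Ω} [NeZero μ]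
    {f g : Ω → ℝ} (hf : Integrable f μ) (hg : Integrable g μ) (h : ∀ᵐ x ∂μ, f x < g x) :
    ∫ x, f x ∂μ < ∫ x, g x ∂μ := by
  have hsupp : Function.support (fun x ↦ g x - f x) =ᵐ[μ] univ := by
    filter_upwards [h] with x hx
    exact eq_true (sub_pos.2 hx).ne'
  rw [← sub_pos, ← integral_sub hg hf,
    integral_pos_iff_support_of_nonneg_ae (h.mono fun x hx ↦ (sub_pos.2 hx).le) (hg.sub hf),
    measure_congr hsupp]
  exact Measure.measure_univ_pos.2 (NeZero.ne μ)

theorem exp_neg_le_rpow_mul {β u : ℝ} (hβ : 0 < β) (hu : 0 < u) :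
    Real.exp (-u) ≤ β ^ β * u ^ (-β) := by
  have key : (u / β) ^ β ≤ Real.exp u := calc
    (u / β) ^ β ≤ Real.exp (u / β) ^ β := by
      gcongr
      linarith [Real.add_one_le_exp (u / β)]
    _ = Real.exp u := by rw [← Real.exp_mul, div_mul_cancel₀ _ hβ.ne']
  rwa [Real.exp_neg, Real.rpow_neg hu.le, ← div_eq_mul_inv, inv_le_comm₀ (Real.exp_pos _)
    (by positivity), inv_div, ← Real.div_rpow hu.le hβ.le]

theorem exp_neg_mul_le_rpow_mul_rpow {β s x : ℝ} (hβ : 0 < β) (hs : 0 < s) (hx : 0 < x) :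
    Real.exp (-(s * x)) ≤ β ^ β * x ^ (-β) * s ^ (-β) := by
  have h := exp_neg_le_rpow_mul hβ (mul_pos hs hx)
  rw [Real.mul_rpow hs.le hx.le] at h
  linarith

/-- The even extension `x ↦ ∫ e^{-s|x|} dμ(s)` of the Laplace transform of `μ`. It is meant for
measures carried by the positive half-line. -/
def laplaceKernel (μ : Measure ℝ) (x : ℝ) : ℝ := ∫ s, Real.exp (-(s * |x|)) ∂μ

variable {μ : Measure ℝ}

theorem laplaceKernel_neg (x : ℝ) : laplaceKernel μ (-x) = laplaceKernel μ x := by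
  simp [laplaceKernel]

theorem laplaceKernel_of_pos {x : ℝ} (hx : 0 < x) :
    laplaceKernel μ x = ∫ s, Real.exp (-(s * x)) ∂μ := by
  rw [laplaceKernel, abs_of_pos hx]

theorem laplaceKernel_nonneg (x : ℝ) : 0 ≤ laplaceKernel μ x :=
  integral_nonneg fun _ ↦ (Real.exp_pos _).le

theorem measurable_laplaceKernel [SFinite μ] : Measurable (laplaceKernel μ) := by
  have h : StronglyMeasurable (Function.uncurry fun x s : ℝ ↦ Real.exp (-(s * |x|))) :=
    Measurable.stronglyMeasurable (by fun_prop)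
  exact h.integral_prod_right.measurable

theorem integrable_exp_neg_mul (hμ : ∀ᵐ s ∂μ, 0 < s) {β : ℝ} (hβ : 0 < β)
    (hi : Integrable (fun s ↦ s ^ (-β)) μ) {x : ℝ} (hx : 0 < x) :
    Integrable (fun s ↦ Real.exp (-(s * x))) μ := by
  refine (hi.const_mul (β ^ β * x ^ (-β))).mono' (by fun_prop) ?_
  filter_upwards [hμ] with s hs
  rw [Real.norm_of_nonneg (Real.exp_pos _).le]
  exact exp_neg_mul_le_rpow_mul_rpow hβ hs hx

theorem laplaceKernel_le_mul_rpow (hμ : ∀ᵐ s ∂μ, 0 < s) {β : ℝ} (hβ : 0 < β)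
    (hi : Integrable (fun s ↦ s ^ (-β)) μ) {x : ℝ} (hx : 0 < x) :
    laplaceKernel μ x ≤ β ^ β * (∫ s, s ^ (-β) ∂μ) * x ^ (-β) := calc
  laplaceKernel μ x ≤ ∫ s, β ^ β * x ^ (-β) * s ^ (-β) ∂μ := by
    rw [laplaceKernel_of_pos hx]
    refine integral_mono_ae (integrable_exp_neg_mul hμ hβ hi hx) (hi.const_mul _) ?_
    filter_upwards [hμ] with s hs
    exact exp_neg_mul_le_rpow_mul_rpow hβ hs hx
  _ = β ^ β * (∫ s, s ^ (-β) ∂μ) * x ^ (-β) := by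
    rw [integral_const_mul]
    ring

theorem contDiffOn_laplaceKernel
    (hexp : ∀ x : ℝ, 0 < x → Integrable (fun s ↦ Real.exp (-(s * x))) μ) :
    ContDiffOn ℝ ∞ (laplaceKernel μ) {0}ᶜ := by
  have hsub : Iio 0 ⊆ interior (ProbabilityTheory.integrableExpSet id μ) := by
    refine interior_maximal (fun t ht ↦ ?_) isOpen_Iio
    refine (hexp (-t) (neg_pos.2 ht)).congr (.of_forall fun s ↦ ?_)
    simp [mul_comm]
  have hmgf : ContDiffOn ℝ ∞ (ProbabilityTheory.mgf id μ) (Iio 0) :=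
    (ProbabilityTheory.analyticOn_mgf.mono hsub).contDiffOn (uniqueDiffOn_Iio 0)
  have hcomp : laplaceKernel μ = ProbabilityTheory.mgf id μ ∘ fun x ↦ -|x| := by
    ext x
    simp [laplaceKernel, ProbabilityTheory.mgf, mul_comm]
  intro x (hx : x ≠ 0)
  rw [hcomp]
  have hmgf_at : ContDiffAt ℝ ∞ (ProbabilityTheory.mgf id μ) (-|x|) :=
    hmgf.contDiffAt (Iio_mem_nhds (neg_neg_of_pos (abs_pos.2 hx)))
  exact (hmgf_at.comp x (contDiffAt_abs hx).neg).contDiffWithinAt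

section NeZero

variable [NeZero μ]

theorem laplaceKernel_pos
    (hexp : ∀ x : ℝ, 0 < x → Integrable (fun s ↦ Real.exp (-(s * x))) μ) {x : ℝ} (hx : x ≠ 0) :
    0 < laplaceKernel μ x :=
  integral_exp_pos (hexp _ (abs_pos.2 hx))

theorem strictAntiOn_laplaceKernel (hμ : ∀ᵐ s ∂μ, 0 < s)
    (hexp : ∀ x : ℝ, 0 < x → Integrable (fun s ↦ Real.exp (-(s * x))) μ) :
    StrictAntiOn (laplaceKernel μ) (Ioi 0) := by
  intro x hx y hy hxy
  rw [laplaceKernel_of_pos hx, laplaceKernel_of_pos hy]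
  refine integral_lt_integral_of_ae_lt (hexp y hy) (hexp x hx) ?_
  filter_upwards [hμ] with s hs
  gcongr

theorem strictConvexOn_laplaceKernel_Ioi (hμ : ∀ᵐ s ∂μ, 0 < s)
    (hexp : ∀ x : ℝ, 0 < x → Integrable (fun s ↦ Real.exp (-(s * x))) μ) :
    StrictConvexOn ℝ (Ioi 0) (laplaceKernel μ) := by
  refine ⟨convex_Ioi 0, fun x hx y hy hxy a b ha hb hab ↦ ?_⟩
  have hz : a • x + b • y ∈ Ioi (0 : ℝ) := convex_Ioi 0 hx hy ha.le hb.le hab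
  have hax := (hexp x hx).const_mul a
  have hby := (hexp y hy).const_mul b
  rw [laplaceKernel_of_pos hx, laplaceKernel_of_pos hy, laplaceKernel_of_pos hz,
    smul_eq_mul a (∫ _, _ ∂_), smul_eq_mul b (∫ _, _ ∂_), ← integral_const_mul,
    ← integral_const_mul, ← integral_add hax hby]
  refine integral_lt_integral_of_ae_lt (hexp _ hz) (hax.add hby) ?_
  filter_upwards [hμ] with s hs
  have hne : -(s * x) ≠ -(s * y) := fun h ↦ hxy (mul_left_cancel₀ hs.ne' (neg_injective h))
  have hlin : -(s * (a * x + b * y)) = a * -(s * x) + b * -(s * y) := by ring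
  simpa only [smul_eq_mul, hlin] using
    strictConvexOn_exp.2 (mem_univ (-(s * x))) (mem_univ (-(s * y))) hne ha hb hab

theorem strictConvexOn_laplaceKernel_Iio (hμ : ∀ᵐ s ∂μ, 0 < s)
    (hexp : ∀ x : ℝ, 0 < x → Integrable (fun s ↦ Real.exp (-(s * x))) μ) :
    StrictConvexOn ℝ (Iio 0) (laplaceKernel μ) := by
  refine ⟨convex_Iio 0, fun x hx y hy hxy a b ha hb hab ↦ ?_⟩
  have h := (strictConvexOn_laplaceKernel_Ioi hμ hexp).2 (mem_Ioi.2 (neg_pos.2 hx))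
    (mem_Ioi.2 (neg_pos.2 hy)) (neg_injective.ne hxy) ha hb hab
  rwa [laplaceKernel_neg, laplaceKernel_neg, smul_neg, smul_neg, ← neg_add,
    laplaceKernel_neg] at h

end NeZero

theorem exp_mul_cexp_eq_cexp (s x ξ : ℝ) :
    (Real.exp (s * x) : ℂ) * Complex.exp (-Complex.I * x * ξ) =
      Complex.exp ((s - Complex.I * ξ) * x) := by
  rw [Complex.ofReal_exp, ← Complex.exp_add]
  congr 1
  push_cast
  ring

theorem integrableOn_Iic_exp_neg_mul_abs_mul_cexp {s : ℝ} (hs : 0 < s) (ξ : ℝ) :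
    IntegrableOn (fun x : ℝ ↦ (Real.exp (-(s * |x|)) : ℂ) * Complex.exp (-Complex.I * x * ξ))
      (Iic 0) ∧
    ∫ x : ℝ in Iic 0, (Real.exp (-(s * |x|)) : ℂ) * Complex.exp (-Complex.I * x * ξ) =
      1 / (s - Complex.I * ξ) := by
  have hre : 0 < (s - Complex.I * ξ).re := by simpa using hs
  have heq : EqOn (fun x : ℝ ↦ Complex.exp ((s - Complex.I * ξ) * x))
      (fun x : ℝ ↦ (Real.exp (-(s * |x|)) : ℂ) * Complex.exp (-Complex.I * x * ξ)) (Iic 0) := by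
    intro x hx
    simp only [abs_of_nonpos (mem_Iic.1 hx), ← exp_mul_cexp_eq_cexp, mul_neg, neg_neg]
  refine ⟨(integrableOn_exp_mul_complex_Iic hre 0).congr_fun heq measurableSet_Iic, ?_⟩
  rw [← setIntegral_congr_fun measurableSet_Iic heq, integral_exp_mul_complex_Iic hre]
  simp

theorem integrableOn_Ioi_exp_neg_mul_abs_mul_cexp {s : ℝ} (hs : 0 < s) (ξ : ℝ) :
    IntegrableOn (fun x : ℝ ↦ (Real.exp (-(s * |x|)) : ℂ) * Complex.exp (-Complex.I * x * ξ))
      (Ioi 0) ∧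
    ∫ x : ℝ in Ioi 0, (Real.exp (-(s * |x|)) : ℂ) * Complex.exp (-Complex.I * x * ξ) =
      1 / (s + Complex.I * ξ) := by
  have hre : (((-s : ℝ) : ℂ) - Complex.I * ξ).re < 0 := by simpa using hs
  have heq : EqOn (fun x : ℝ ↦ Complex.exp ((((-s : ℝ) : ℂ) - Complex.I * ξ) * x))
      (fun x : ℝ ↦ (Real.exp (-(s * |x|)) : ℂ) * Complex.exp (-Complex.I * x * ξ)) (Ioi 0) := by
    intro x hx
    simp only [abs_of_pos (mem_Ioi.1 hx), ← exp_mul_cexp_eq_cexp, neg_mul]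
  refine ⟨(integrableOn_exp_mul_complex_Ioi hre 0).congr_fun heq measurableSet_Ioi, ?_⟩
  rw [← setIntegral_congr_fun measurableSet_Ioi heq, integral_exp_mul_complex_Ioi hre,
    Complex.ofReal_zero, mul_zero, Complex.exp_zero, Complex.ofReal_neg, ← neg_add', neg_div_neg_eq]

theorem integrable_exp_neg_mul_abs_mul_cexp {s : ℝ} (hs : 0 < s) (ξ : ℝ) :
    Integrable fun x : ℝ ↦ (Real.exp (-(s * |x|)) : ℂ) * Complex.exp (-Complex.I * x * ξ) := by
  rw [← integrableOn_univ, ← Iic_union_Ioi (a := (0 : ℝ))]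
  exact (integrableOn_Iic_exp_neg_mul_abs_mul_cexp hs ξ).1.union
    (integrableOn_Ioi_exp_neg_mul_abs_mul_cexp hs ξ).1

theorem integral_exp_neg_mul_abs_mul_cexp {s : ℝ} (hs : 0 < s) (ξ : ℝ) :
    ∫ x : ℝ, (Real.exp (-(s * |x|)) : ℂ) * Complex.exp (-Complex.I * x * ξ) =
      ((2 * s / (s ^ 2 + ξ ^ 2) : ℝ) : ℂ) := by
  obtain ⟨hIic, hIic_eq⟩ := integrableOn_Iic_exp_neg_mul_abs_mul_cexp hs ξ
  obtain ⟨hIoi, hIoi_eq⟩ := integrableOn_Ioi_exp_neg_mul_abs_mul_cexp hs ξ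
  have hsub : (s - Complex.I * ξ : ℂ) ≠ 0 := fun h ↦ hs.ne' (by simpa using congrArg Complex.re h)
  have hadd : (s + Complex.I * ξ : ℂ) ≠ 0 := fun h ↦ hs.ne' (by simpa using congrArg Complex.re h)
  have hmul : ((s : ℂ) ^ 2 + ξ ^ 2) = (s - Complex.I * ξ) * (s + Complex.I * ξ) := by
    linear_combination ((ξ : ℂ) ^ 2) * Complex.I_sq
  rw [← intervalIntegral.integral_Iic_add_Ioi hIic hIoi, hIic_eq, hIoi_eq]
  push_cast
  rw [hmul]
  field_simp
  ring

theorem norm_exp_neg_mul_abs_mul_cexp (s x ξ : ℝ) :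
    ‖(Real.exp (-(s * |x|)) : ℂ) * Complex.exp (-Complex.I * x * ξ)‖ = Real.exp (-(s * |x|)) := by
  rw [norm_mul, Complex.norm_exp, Complex.norm_real, Real.norm_of_nonneg (Real.exp_pos _).le]
  simp

theorem integral_exp_neg_mul_abs {s : ℝ} (hs : 0 < s) :
    ∫ x : ℝ, Real.exp (-(s * |x|)) = 2 * s⁻¹ := by
  have h := integral_exp_neg_mul_abs_mul_cexp hs 0
  simp only [Complex.ofReal_zero, mul_zero, Complex.exp_zero, mul_one] at h
  rw [integral_complex_ofReal, Complex.ofReal_inj] at h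
  rw [h]
  field

section Fourier

variable [SFinite μ]

theorem integrable_prod_exp_neg_mul_abs_mul_cexp (hμ : ∀ᵐ s ∂μ, 0 < s)
    (hi : Integrable (fun s ↦ s⁻¹) μ) (ξ : ℝ) :
    Integrable (Function.uncurry fun x s : ℝ ↦
      (Real.exp (-(s * |x|)) : ℂ) * Complex.exp (-Complex.I * x * ξ))
      ((volume : Measure ℝ).prod μ) := by
  rw [integrable_prod_iff' (Measurable.aestronglyMeasurable (by fun_prop))]
  constructor
  · filter_upwards [hμ] with s hs
    exact integrable_exp_neg_mul_abs_mul_cexp hs ξ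
  · refine (hi.const_mul 2).congr ?_
    filter_upwards [hμ] with s hs
    simp only [Function.uncurry, norm_exp_neg_mul_abs_mul_cexp, integral_exp_neg_mul_abs hs]

theorem integrable_prod_exp_neg_mul_abs (hμ : ∀ᵐ s ∂μ, 0 < s)
    (hi : Integrable (fun s ↦ s⁻¹) μ) :
    Integrable (Function.uncurry fun x s : ℝ ↦ Real.exp (-(s * |x|)))
      ((volume : Measure ℝ).prod μ) := by
  refine (integrable_prod_exp_neg_mul_abs_mul_cexp hμ hi 0).norm.congr (.of_forall fun z ↦ ?_)
  exact norm_exp_neg_mul_abs_mul_cexp z.2 z.1 0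

theorem integrable_laplaceKernel (hμ : ∀ᵐ s ∂μ, 0 < s) (hi : Integrable (fun s ↦ s⁻¹) μ) :
    Integrable (laplaceKernel μ) :=
  (integrable_prod_exp_neg_mul_abs hμ hi).integral_prod_left

theorem integral_laplaceKernel_mul_cexp (hμ : ∀ᵐ s ∂μ, 0 < s)
    (hi : Integrable (fun s ↦ s⁻¹) μ) (ξ : ℝ) :
    ∫ x : ℝ, (laplaceKernel μ x : ℂ) * Complex.exp (-Complex.I * x * ξ) =
      ((∫ s, 2 * s / (s ^ 2 + ξ ^ 2) ∂μ : ℝ) : ℂ) := calc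
  ∫ x : ℝ, (laplaceKernel μ x : ℂ) * Complex.exp (-Complex.I * x * ξ)
    = ∫ x : ℝ, ∫ s, (Real.exp (-(s * |x|)) : ℂ) * Complex.exp (-Complex.I * x * ξ) ∂μ := by
      refine integral_congr_ae (.of_forall fun x ↦ ?_)
      simp only [integral_mul_const, integral_complex_ofReal, laplaceKernel]
  _ = ∫ s, (∫ x : ℝ, (Real.exp (-(s * |x|)) : ℂ) * Complex.exp (-Complex.I * x * ξ)) ∂μ :=
      integral_integral_swap (integrable_prod_exp_neg_mul_abs_mul_cexp hμ hi ξ)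
  _ = ((∫ s, 2 * s / (s ^ 2 + ξ ^ 2) ∂μ : ℝ) : ℂ) := by
      rw [← integral_complex_ofReal]
      refine integral_congr_ae ?_
      filter_upwards [hμ] with s hs
      exact integral_exp_neg_mul_abs_mul_cexp hs ξ

theorem integral_exp_neg_mul_abs_Ioc {s : ℝ} (hs : 0 < s) {r : ℝ} (hr : 0 ≤ r) :
    ∫ x in Ioc 0 r, Real.exp (-(s * |x|)) = (1 - Real.exp (-(s * r))) / s := by
  have habs : EqOn (fun x ↦ Real.exp (-(s * |x|))) (fun x ↦ Real.exp (-s * x)) (Ioc 0 r) := by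
    intro x hx
    simp only [abs_of_pos hx.1, neg_mul]
  rw [setIntegral_congr_fun measurableSet_Ioc habs, ← intervalIntegral.integral_of_le hr,
    intervalIntegral.integral_comp_mul_left Real.exp (neg_ne_zero.2 hs.ne'), integral_exp, mul_zero,
    Real.exp_zero, smul_eq_mul, neg_mul]
  field_simp
  ring

theorem two_mul_div_le_integral_exp_neg {s ξ : ℝ} (hs : 0 < s) (hξ : 0 < ξ) :
    2 * s / (s ^ 2 + ξ ^ 2) ≤ 4 * ∫ x in Ioc 0 ξ⁻¹, Real.exp (-(s * |x|)) := by
  rw [integral_exp_neg_mul_abs_Ioc hs (inv_nonneg.2 hξ.le)]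
  have hexp : Real.exp (-(s * ξ⁻¹)) ≤ ξ / (s + ξ) := by
    rw [Real.exp_neg, inv_le_comm₀ (Real.exp_pos _) (by positivity), inv_div]
    have := Real.add_one_le_exp (s * ξ⁻¹)
    rwa [← div_eq_mul_inv, div_add_one hξ.ne'] at this
  calc 2 * s / (s ^ 2 + ξ ^ 2) ≤ 4 * ((1 - ξ / (s + ξ)) / s) := by
        have : 4 * ((1 - ξ / (s + ξ)) / s) = 4 / (s + ξ) := by field_simp; ring
        rw [this, div_le_div_iff₀ (by positivity) (by positivity)]
        nlinarith [sq_nonneg (s - ξ)]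
    _ ≤ 4 * ((1 - Real.exp (-(s * ξ⁻¹))) / s) := by gcongr

theorem integral_two_mul_div_le_setIntegral_laplaceKernel (hμ : ∀ᵐ s ∂μ, 0 < s)
    (hi : Integrable (fun s ↦ s⁻¹) μ) {ξ : ℝ} (hξ : 0 < ξ) :
    ∫ s, 2 * s / (s ^ 2 + ξ ^ 2) ∂μ ≤ 4 * ∫ x in Ioc 0 ξ⁻¹, laplaceKernel μ x := by
  have hprod : Integrable (Function.uncurry fun x s : ℝ ↦ Real.exp (-(s * |x|)))
      ((volume.restrict (Ioc 0 ξ⁻¹)).prod μ) :=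
    (integrable_prod_exp_neg_mul_abs hμ hi).mono_measure
      (Measure.prod_mono Measure.restrict_le_self le_rfl)
  unfold laplaceKernel
  rw [integral_integral_swap hprod, ← integral_const_mul]
  refine integral_mono_of_nonneg ?_ (hprod.integral_prod_right.const_mul 4) ?_
  · filter_upwards [hμ] with s hs
    simp only [Pi.zero_apply]
    positivity
  · filter_upwards [hμ] with s hs
    exact two_mul_div_le_integral_exp_neg hs hξ

end Fourier

end LaplaceKernel

section LebesgueSpaces

theorem integrable_of_integrableOn_Ioi {E : Type*} [NormedAddCommGroup E] {f : ℝ → E}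
    (hneg : IntegrableOn (fun x ↦ f (-x)) (Ioi 0)) (hpos : IntegrableOn f (Ioi 0)) :
    Integrable f := by
  have hIio : IntegrableOn f (Iio 0) := by
    refine ((Measure.measurePreserving_neg (volume : Measure ℝ)).integrableOn_comp_preimage
      (Homeomorph.neg ℝ).measurableEmbedding).1 ?_
    rwa [show (Neg.neg ⁻¹' Iio 0 : Set ℝ) = Ioi 0 by ext; simp]
  rw [← integrableOn_univ, ← Iic_union_Ioi (a := (0 : ℝ))]
  exact ((integrableOn_Iic_iff_integrableOn_Iio (f := f)).2 hIio).union hpos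

theorem integrableOn_Ioi_of_norm_le_mul_rpow {E : Type*} [NormedAddCommGroup E] {f : ℝ → E}
    (hf : AEStronglyMeasurable f) {a b C D : ℝ} (ha : a < 1) (hb : 1 < b)
    (hfa : ∀ x, 0 < x → ‖f x‖ ≤ C * x ^ (-a)) (hfb : ∀ x, 0 < x → ‖f x‖ ≤ D * x ^ (-b)) :
    IntegrableOn f (Ioi 0) := by
  have hnear : IntegrableOn f (Ioc 0 1) := by
    have hpow : IntegrableOn (fun x : ℝ ↦ x ^ (-a)) (Ioc 0 1) :=
      (intervalIntegrable_iff_integrableOn_Ioc_of_le zero_le_one).1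
        (intervalIntegral.intervalIntegrable_rpow' (by linarith))
    refine (hpow.const_mul C).mono' hf.restrict ?_
    filter_upwards [ae_restrict_mem measurableSet_Ioc] with x hx
    exact hfa x hx.1
  have hfar : IntegrableOn f (Ioi 1) := by
    refine ((integrableOn_Ioi_rpow_of_lt (neg_lt_neg hb) one_pos).const_mul D).mono' hf.restrict ?_
    filter_upwards [ae_restrict_mem measurableSet_Ioi] with x hx
    exact hfb x (one_pos.trans hx)
  rw [← Ioc_union_Ioi_eq_Ioi zero_le_one]
  exact hnear.union hfar

theorem norm_rpow_norm_le_mul_rpow {E : Type*} [NormedAddCommGroup E] {f : ℝ → E} {a C q : ℝ}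
    (hq : 0 ≤ q) (hf : ∀ x, 0 < x → ‖f x‖ ≤ C * x ^ (-a)) (x : ℝ) (hx : 0 < x) :
    ‖‖f x‖ ^ q‖ ≤ C ^ q * x ^ (-(a * q)) := by
  have hC : 0 ≤ C := by simpa using (norm_nonneg _).trans (hf 1 one_pos)
  rw [Real.norm_of_nonneg (by positivity), ← neg_mul, Real.rpow_mul hx.le,
    ← Real.mul_rpow hC (by positivity)]
  exact Real.rpow_le_rpow (norm_nonneg _) (hf x hx) hq

theorem memLp_of_even_of_norm_le_mul_rpow {E : Type*} [NormedAddCommGroup E] {f : ℝ → E}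
    (hf : AEStronglyMeasurable f) (heven : ∀ x, f (-x) = f x) {p : ℝ≥0∞} (hp : p ≠ 0)
    (hp_top : p ≠ ⊤) {a b C D : ℝ} (ha : a * p.toReal < 1) (hb : 1 < b * p.toReal)
    (hfa : ∀ x, 0 < x → ‖f x‖ ≤ C * x ^ (-a)) (hfb : ∀ x, 0 < x → ‖f x‖ ≤ D * x ^ (-b)) :
    MemLp f p := by
  have hIoi : IntegrableOn (fun x ↦ ‖f x‖ ^ p.toReal) (Ioi 0) :=
    integrableOn_Ioi_of_norm_le_mul_rpow (hf.norm.aemeasurable.pow_const _).aestronglyMeasurable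
      ha hb (norm_rpow_norm_le_mul_rpow ENNReal.toReal_nonneg hfa)
      (norm_rpow_norm_le_mul_rpow ENNReal.toReal_nonneg hfb)
  rw [← integrable_norm_rpow_iff hf hp hp_top]
  exact integrable_of_integrableOn_Ioi (by simpa only [heven] using hIoi) hIoi

theorem enorm_setIntegral_Ioc_le_eLpNorm_mul_rpow {f : ℝ → ℝ} (hf : AEStronglyMeasurable f)
    {q : ℝ≥0∞} (hq : 1 ≤ q) (x : ℝ) :
    ‖∫ t in Ioc 0 x, f t‖ₑ ≤
      eLpNorm f q (volume.restrict (Ioc 0 x)) * ENNReal.ofReal x ^ (1 - 1 / q.toReal) := by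
  refine (enorm_integral_le_lintegral_enorm _).trans ?_
  rw [← eLpNorm_one_eq_lintegral_enorm]
  simpa using eLpNorm_le_eLpNorm_mul_rpow_measure_univ hq (hf.restrict (s := Ioc 0 x))

theorem exists_eLpNorm_restrict_Ioc_le {f : ℝ → ℝ} {q : ℝ≥0∞} (hq : 1 ≤ q) (hq_top : q ≠ ⊤)
    (hf : MemLp f q (volume.restrict (Ioc 0 1))) {ε : ℝ} (hε : 0 < ε) :
    ∃ x ∈ Ioc (0 : ℝ) 1, eLpNorm f q (volume.restrict (Ioc 0 x)) ≤ ENNReal.ofReal ε := by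
  obtain ⟨δ, hδ, hsmall⟩ := hf.eLpNorm_indicator_le hq hq_top hε
  have hx : Ioc 0 (min δ 1) ⊆ Ioc (0 : ℝ) 1 := Ioc_subset_Ioc_right (min_le_right _ _)
  refine ⟨min δ 1, ⟨lt_min hδ one_pos, min_le_right _ _⟩, ?_⟩
  rw [← Measure.restrict_restrict_of_subset hx,
    ← eLpNorm_indicator_eq_eLpNorm_restrict measurableSet_Ioc]
  refine hsmall _ measurableSet_Ioc ((Measure.restrict_apply_le _ _).trans ?_)
  rw [Real.volume_Ioc]
  exact ENNReal.ofReal_le_ofReal (by simp)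

theorem lt_of_memLp_of_mul_rpow_le_setIntegral {f : ℝ → ℝ} {α c : ℝ} (hα : α ∈ Ioo (0 : ℝ) 1)
    (hc : 0 < c) (hle : ∀ x ∈ Ioc (0 : ℝ) 1, c * x ^ α ≤ ∫ t in Ioc 0 x, f t) {p : ℝ≥0∞}
    (hf : MemLp f p) : p < ENNReal.ofReal (1 / (1 - α)) := by
  by_contra! hp
  have hα' : 0 < 1 - α := sub_pos.2 hα.2
  have hq : 1 ≤ ENNReal.ofReal (1 / (1 - α)) := by
    rw [ENNReal.one_le_ofReal]
    exact one_le_one_div hα' (by linarith [hα.1])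
  have hexp : 1 - 1 / (ENNReal.ofReal (1 / (1 - α))).toReal = α := by
    rw [ENNReal.toReal_ofReal (by positivity), one_div_one_div, sub_sub_cancel]
  obtain ⟨x, hx, hsmall⟩ := exists_eLpNorm_restrict_Ioc_le hq ENNReal.ofReal_ne_top
    ((hf.restrict _).mono_exponent hp) (half_pos hc)
  have holder : ENNReal.ofReal (c * x ^ α) ≤ ENNReal.ofReal (c / 2 * x ^ α) := calc
    ENNReal.ofReal (c * x ^ α) ≤ ‖∫ t in Ioc 0 x, f t‖ₑ :=
      (ENNReal.ofReal_le_ofReal ((hle x hx).trans (le_abs_self _))).trans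
        (Real.enorm_eq_ofReal_abs _).ge
    _ ≤ ENNReal.ofReal (c / 2) * ENNReal.ofReal x ^ α := by
      refine (enorm_setIntegral_Ioc_le_eLpNorm_mul_rpow hf.1 hq x).trans ?_
      rw [hexp]
      gcongr
    _ = ENNReal.ofReal (c / 2 * x ^ α) := by
      rw [ENNReal.ofReal_mul (by positivity), ENNReal.ofReal_rpow_of_pos hx.1]
  have hxα : 0 < x ^ α := Real.rpow_pos_of_pos hx.1 α
  rw [ENNReal.ofReal_le_ofReal_iff (by positivity)] at holder
  nlinarith

/-- The kernel `f` with its peak cut off at height `f r`. -/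
def truncatePeak (f : ℝ → ℝ) (r x : ℝ) : ℝ := f (max |x| r)

section BellShape

variable {f : ℝ → ℝ} {r : ℝ}

theorem apply_abs_of_even (heven : ∀ x, f (-x) = f x) (x : ℝ) : f |x| = f x := by
  rcases abs_choice x with h | h <;> rw [h]
  exact heven x

theorem continuous_truncatePeak (hcont : ContinuousOn f {0}ᶜ) (hr : 0 < r) :
    Continuous (truncatePeak f r) :=
  hcont.comp_continuous (by fun_prop) fun _ ↦ (lt_max_of_lt_right hr).ne'

theorem antitoneOn_truncatePeak (hanti : AntitoneOn f (Ioi 0)) (hr : 0 < r) :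
    AntitoneOn (truncatePeak f r) (Ici 0) := by
  intro x hx y hy hxy
  refine hanti (lt_max_of_lt_right hr) (lt_max_of_lt_right hr) ?_
  rw [abs_of_nonneg hx, abs_of_nonneg hy]
  exact max_le_max_right r hxy

theorem truncatePeak_le (heven : ∀ x, f (-x) = f x) (hanti : AntitoneOn f (Ioi 0)) (hr : 0 < r)
    {x : ℝ} (hx : x ≠ 0) : truncatePeak f r x ≤ f x := by
  rw [← apply_abs_of_even heven x]
  exact hanti (abs_pos.2 hx) (lt_max_of_lt_right hr) (le_max_left _ _)

theorem truncatePeak_of_le_abs (heven : ∀ x, f (-x) = f x) {x : ℝ} (hx : r ≤ |x|) :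
    truncatePeak f r x = f x := by
  rw [truncatePeak, max_eq_left hx, apply_abs_of_even heven]

theorem norm_sub_truncatePeak_le (heven : ∀ x, f (-x) = f x) (hpos : ∀ x, x ≠ 0 → 0 < f x)
    (hanti : AntitoneOn f (Ioi 0)) (hr : 0 < r) {x : ℝ} (hx : x ≠ 0) :
    ‖f x - truncatePeak f r x‖ ≤ ‖(Ioo (-r) r).indicator f x‖ := by
  rcases lt_or_ge |x| r with hxr | hxr
  · have htrunc : 0 < truncatePeak f r x := hpos _ (lt_max_of_lt_right hr).ne'
    rw [indicator_of_mem (mem_Ioo.2 (abs_lt.1 hxr)), Real.norm_of_nonneg (hpos x hx).le,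
      Real.norm_of_nonneg (sub_nonneg.2 (truncatePeak_le heven hanti hr hx))]
    linarith
  · rw [truncatePeak_of_le_abs heven hxr, sub_self, norm_zero]
    exact norm_nonneg _

theorem isBellShaped_of_antitoneOn (heven : ∀ x, f (-x) = f x) (hcont : ContinuousOn f {0}ᶜ)
    (hpos : ∀ x, x ≠ 0 → 0 < f x) (hanti : AntitoneOn f (Ioi 0)) {p : ℝ≥0∞} (hp : 1 ≤ p)
    (hp_top : p ≠ ⊤) (hf : MemLp f p) : IsBellShaped p f := by
  refine ⟨hf, fun ε hε ↦ ?_⟩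
  obtain ⟨η, -, hη, hηε⟩ := ENNReal.lt_iff_exists_real_btwn.1 hε
  obtain ⟨δ, hδ, hsmall⟩ := hf.eLpNorm_indicator_le hp hp_top (ENNReal.ofReal_pos.1 hη)
  have hr : 0 < δ / 2 := half_pos hδ
  have hne : ∀ᵐ x : ℝ, x ≠ 0 := by simp [ae_iff]
  have htrunc_pos : ∀ x, 0 < truncatePeak f (δ / 2) x :=
    fun _ ↦ hpos _ (lt_max_of_lt_right hr).ne'
  refine ⟨truncatePeak f (δ / 2), ?_, continuous_truncatePeak hcont hr, fun x ↦ ?_, htrunc_pos,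
    antitoneOn_truncatePeak hanti hr, ?_⟩
  · refine hf.mono (continuous_truncatePeak hcont hr).aestronglyMeasurable ?_
    filter_upwards [hne] with x hx
    rw [Real.norm_of_nonneg (htrunc_pos x).le, Real.norm_of_nonneg (hpos x hx).le]
    exact truncatePeak_le heven hanti hr hx
  · simp only [truncatePeak, abs_neg]
  · refine lt_of_le_of_lt ?_ hηε
    refine le_trans ?_ (hsmall (Ioo (-(δ / 2)) (δ / 2)) measurableSet_Ioo (by simp))
    exact eLpNorm_mono_ae (hne.mono fun x hx ↦ norm_sub_truncatePeak_le heven hpos hanti hr hx)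

end BellShape

end LebesgueSpaces

section Convolution

variable {K : ℝ → ℝ} {p C : ℝ≥0∞}

/-- The law with density `y ↦ K (x - y)`, against which the convolution `K * f` integrates `f`. -/
def reflectedTranslate (K : ℝ → ℝ) (x : ℝ) : Measure ℝ :=
  volume.withDensity fun y ↦ ENNReal.ofReal (K (x - y))

theorem reflectedTranslate_absolutelyContinuous (x : ℝ) : reflectedTranslate K x ≪ volume :=
  withDensity_absolutelyContinuous _ _

theorem lintegral_reflectedTranslate (hK : Measurable K) {g : ℝ → ℝ≥0∞} (hg : AEMeasurable g)
    (x : ℝ) :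
    ∫⁻ y, g y ∂reflectedTranslate K x = ∫⁻ y, ENNReal.ofReal (K (x - y)) * g y :=
  lintegral_withDensity_eq_lintegral_mul₀ (by fun_prop) hg

theorem lintegral_ofReal_eq_one (hint : Integrable K) (hnonneg : 0 ≤ K) (hone : ∫ x, K x = 1) :
    ∫⁻ x, ENNReal.ofReal (K x) = 1 := by
  rw [← ofReal_integral_eq_lintegral_ofReal hint (.of_forall hnonneg), hone, ENNReal.ofReal_one]

theorem isProbabilityMeasure_reflectedTranslate (hone : ∫⁻ x, ENNReal.ofReal (K x) = 1) (x : ℝ) :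
    IsProbabilityMeasure (reflectedTranslate K x) := by
  refine ⟨?_⟩
  rw [reflectedTranslate, withDensity_apply _ MeasurableSet.univ, Measure.restrict_univ,
    lintegral_sub_left_eq_self (fun y ↦ ENNReal.ofReal (K y)) x, hone]

theorem enorm_convolution_le_eLpNorm (hK : Measurable K) (hnonneg : 0 ≤ K)
    (hone : ∫⁻ x, ENNReal.ofReal (K x) = 1) (hp : 1 ≤ p) {f : ℝ → ℝ}
    (hf : AEStronglyMeasurable f) (x : ℝ) :
    ‖∫ y, K (x - y) * f y‖ₑ ≤ eLpNorm f p (reflectedTranslate K x) := by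
  have := isProbabilityMeasure_reflectedTranslate hone x
  calc ‖∫ y, K (x - y) * f y‖ₑ ≤ ∫⁻ y, ENNReal.ofReal (K (x - y)) * ‖f y‖ₑ := by
        refine (enorm_integral_le_lintegral_enorm _).trans_eq (lintegral_congr fun y ↦ ?_)
        rw [enorm_mul, Real.enorm_of_nonneg (hnonneg _)]
    _ = eLpNorm f 1 (reflectedTranslate K x) := by
        rw [eLpNorm_one_eq_lintegral_enorm, lintegral_reflectedTranslate hK hf.enorm]
    _ ≤ eLpNorm f p (reflectedTranslate K x) :=
        eLpNorm_le_eLpNorm_of_exponent_le hp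
          (hf.mono_ac (reflectedTranslate_absolutelyContinuous x))

theorem lintegral_lintegral_reflectedTranslate (hK : Measurable K)
    (hone : ∫⁻ x, ENNReal.ofReal (K x) = 1) {g : ℝ → ℝ≥0∞} (hg : AEMeasurable g) :
    ∫⁻ x, (∫⁻ y, g y ∂reflectedTranslate K x) = ∫⁻ y, g y := calc
  ∫⁻ x, (∫⁻ y, g y ∂reflectedTranslate K x)
    = ∫⁻ x, ∫⁻ y, ENNReal.ofReal (K (x - y)) * g y := by
      simp only [lintegral_reflectedTranslate hK hg]
  _ = ∫⁻ y, ∫⁻ x, ENNReal.ofReal (K (x - y)) * g y :=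
      lintegral_lintegral_swap (AEMeasurable.mul (by fun_prop) hg.comp_snd)
  _ = ∫⁻ y, g y := by
      refine lintegral_congr fun y ↦ ?_
      rw [lintegral_mul_const _ (by fun_prop),
        lintegral_sub_right_eq_self (fun x ↦ ENNReal.ofReal (K x)) y, hone, one_mul]

theorem isConvolutionBound_one (hK : Measurable K) (hint : Integrable K) (hnonneg : 0 ≤ K)
    (hone : ∫ x, K x = 1) (hp : 1 ≤ p) : IsConvolutionBound K p 1 := by
  intro f hf
  have hmass := lintegral_ofReal_eq_one hint hnonneg hone
  have jensen := enorm_convolution_le_eLpNorm hK hnonneg hmass hp hf.1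
  rw [one_mul]
  rcases eq_or_ne p ⊤ with rfl | hp_top
  · simp only [eLpNorm_exponent_top] at jensen ⊢
    exact eLpNormEssSup_le_of_ae_enorm_bound (.of_forall fun x ↦ (jensen x).trans
      (eLpNormEssSup_mono_measure f (reflectedTranslate_absolutelyContinuous x)))
  have hp0 : p ≠ 0 := (one_pos.trans_le hp).ne'
  have hp_pos : 0 < p.toReal := ENNReal.toReal_pos hp0 hp_top
  simp only [eLpNorm_eq_lintegral_rpow_enorm_toReal hp0 hp_top] at jensen ⊢
  refine ENNReal.rpow_le_rpow ?_ (by positivity)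
  calc ∫⁻ x, ‖∫ y, K (x - y) * f y‖ₑ ^ p.toReal
      ≤ ∫⁻ x, (∫⁻ y, ‖f y‖ₑ ^ p.toReal ∂reflectedTranslate K x) := by
        refine lintegral_mono fun x ↦ ?_
        exact (ENNReal.le_rpow_inv_iff hp_pos).1 ((jensen x).trans_eq (by rw [one_div]))
    _ = ∫⁻ y, ‖f y‖ₑ ^ p.toReal :=
        lintegral_lintegral_reflectedTranslate hK hmass (hf.1.enorm.pow_const _)

theorem integral_le_convolution_indicator (hint : Integrable K) (hnonneg : 0 ≤ K) {A R x : ℝ}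
    (hx : x ∈ Icc (-R) R) :
    ∫ u in Ioc (-A) A, K u ≤
      ∫ y, K (x - y) * (Icc (-(R + A)) (R + A)).indicator (fun _ ↦ 1) y := by
  have hmeas : Measurable ((Icc (-(R + A)) (R + A)).indicator fun _ ↦ (1 : ℝ)) :=
    measurable_const.indicator measurableSet_Icc
  rw [← integral_sub_left_eq_self _ volume x, ← integral_indicator measurableSet_Ioc]
  simp only [sub_sub_cancel]
  refine integral_mono (hint.indicator measurableSet_Ioc) ?_ fun u ↦ ?_
  · refine hint.mul_bdd (c := 1) (hmeas.comp (by fun_prop)).aestronglyMeasurable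
      (.of_forall fun u ↦ (norm_indicator_le_norm_self _ _).trans (by simp))
  · by_cases hu : u ∈ Ioc (-A) A
    · have hxu : x - u ∈ Icc (-(R + A)) (R + A) :=
        ⟨by linarith [hx.1, hu.2], by linarith [hx.2, hu.1]⟩
      simp only [indicator_of_mem hu, indicator_of_mem hxu, mul_one, le_refl]
    · rw [indicator_of_notMem hu]
      exact mul_nonneg (hnonneg u) (indicator_nonneg (fun _ _ ↦ zero_le_one) _)

theorem eLpNorm_indicator_Icc_neg_self (hp : p ≠ 0) {R c : ℝ} (hR : 0 < R) (hc : 0 ≤ c) :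
    eLpNorm ((Icc (-R) R).indicator fun _ ↦ c) p =
      ENNReal.ofReal c * ENNReal.ofReal (2 * R) ^ (1 / p.toReal) := by
  have hvol : volume (Icc (-R) R) = ENNReal.ofReal (2 * R) := by
    rw [Real.volume_Icc, sub_neg_eq_add, two_mul]
  rw [eLpNorm_indicator_const' measurableSet_Icc (by simpa [hvol] using hR) hp, hvol,
    Real.enorm_of_nonneg hc]

theorem one_div_toReal_le_one (hp : 1 ≤ p) : 1 / p.toReal ≤ 1 := by
  rcases eq_or_ne p ⊤ with rfl | hp_top
  · simp
  · exact div_le_one_of_le₀ (by simpa using ENNReal.toReal_mono hp_top hp) (by positivity)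

theorem IsConvolutionBound.ofReal_integral_le (hC : IsConvolutionBound K p C)
    (hint : Integrable K) (hnonneg : 0 ≤ K) (hp : 1 ≤ p) {A R : ℝ} (hA : 0 ≤ A) (hR : 0 < R) :
    ENNReal.ofReal (∫ u in Ioc (-A) A, K u) ≤ C * ENNReal.ofReal (1 + A / R) := by
  have hp0 : p ≠ 0 := (one_pos.trans_le hp).ne'
  have hmass : 0 ≤ ∫ u in Ioc (-A) A, K u := integral_nonneg hnonneg
  have hle : eLpNorm ((Icc (-R) R).indicator fun _ ↦ ∫ u in Ioc (-A) A, K u) p ≤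
      C * eLpNorm ((Icc (-(R + A)) (R + A)).indicator fun _ ↦ (1 : ℝ)) p := by
    refine (eLpNorm_mono fun x ↦ ?_).trans
      (hC _ (memLp_indicator_const p measurableSet_Icc 1 (.inr (by simp))))
    by_cases hx : x ∈ Icc (-R) R
    · rw [indicator_of_mem hx, Real.norm_of_nonneg hmass]
      exact (integral_le_convolution_indicator hint hnonneg hx).trans (Real.le_norm_self _)
    · rw [indicator_of_notMem hx, norm_zero]
      exact norm_nonneg _
  rw [eLpNorm_indicator_Icc_neg_self hp0 hR hmass, eLpNorm_indicator_Icc_neg_self hp0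
    (by positivity) zero_le_one, ENNReal.ofReal_one, one_mul,
    show 2 * (R + A) = (1 + A / R) * (2 * R) by field,
    ENNReal.ofReal_mul (p := 1 + A / R) (by positivity),
    ENNReal.mul_rpow_of_nonneg _ _ (by positivity), ← mul_assoc,
    ENNReal.mul_le_mul_iff_left (by simp [ENNReal.rpow_eq_zero_iff, hR])
      (ENNReal.rpow_ne_top_of_nonneg (by positivity) ENNReal.ofReal_ne_top)] at hle
  refine hle.trans (mul_le_mul_right ?_ C)
  calc ENNReal.ofReal (1 + A / R) ^ (1 / p.toReal) ≤ ENNReal.ofReal (1 + A / R) ^ (1 : ℝ) :=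
        ENNReal.rpow_le_rpow_of_exponent_le
          (ENNReal.one_le_ofReal.2 (le_add_of_nonneg_right (by positivity)))
          (one_div_toReal_le_one hp)
    _ = ENNReal.ofReal (1 + A / R) := ENNReal.rpow_one _

theorem IsConvolutionBound.one_le (hC : IsConvolutionBound K p C) (hint : Integrable K)
    (hnonneg : 0 ≤ K) (hone : ∫ x, K x = 1) (hp : 1 ≤ p) : 1 ≤ C := by
  have htail : ∀ A : ℝ, 0 ≤ A → ENNReal.ofReal (∫ u in Ioc (-A) A, K u) ≤ C := by
    intro A hA
    have hratio : Tendsto (fun R : ℝ ↦ ENNReal.ofReal (1 + A / R)) atTop (𝓝 1) := by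
      simpa using ENNReal.tendsto_ofReal ((tendsto_const_nhds.div_atTop tendsto_id).const_add 1)
    have hlim : Tendsto (fun R : ℝ ↦ C * ENNReal.ofReal (1 + A / R)) atTop (𝓝 C) := by
      simpa using ENNReal.Tendsto.const_mul hratio (.inl one_ne_zero)
    refine ge_of_tendsto hlim ?_
    filter_upwards [eventually_gt_atTop 0] with R hR
    exact hC.ofReal_integral_le hint hnonneg hp hA hR
  have hlim : Tendsto (fun A : ℝ ↦ ENNReal.ofReal (∫ u in (-A)..A, K u)) atTop (𝓝 1) := by
    rw [← ENNReal.ofReal_one, ← hone]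
    exact ENNReal.tendsto_ofReal
      (intervalIntegral_tendsto_integral hint tendsto_neg_atTop_atBot tendsto_id)
  refine le_of_tendsto hlim ?_
  filter_upwards [eventually_ge_atTop 0] with A hA
  rw [intervalIntegral.integral_of_le (by linarith)]
  exact htail A hA

theorem isLeast_isConvolutionBound (hK : Measurable K) (hint : Integrable K) (hnonneg : 0 ≤ K)
    (hone : ∫ x, K x = 1) (hp : 1 ≤ p) : IsLeast {C : ℝ≥0∞ | IsConvolutionBound K p C} 1 :=
  ⟨isConvolutionBound_one hK hint hnonneg hone hp, fun _ hC ↦ hC.one_le hint hnonneg hone hp⟩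

end Convolution

section StieltjesRepresentation

theorem norm_integral_vertical_segment_le {G : ℂ → ℂ} {ε R M : ℝ} (hε : 0 ≤ ε) (hR : 0 ≤ R)
    (hG : DifferentiableOn ℂ G {z | ε ≤ z.re})
    (hM : ∀ z : ℂ, ε ≤ z.re → R ≤ ‖z‖ → ‖G z‖ ≤ M) :
    ‖∫ y in (-R)..R, G (ε + y * Complex.I)‖ ≤ 4 * R * M := by
  have hcauchy := Complex.integral_boundary_rect_eq_zero_of_differentiableOn G
    ⟨ε, -R⟩ ⟨ε + R, R⟩ (hG.mono fun z hz ↦ by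
      have hre := (Complex.mem_reProdIm.1 hz).1
      rw [uIcc_of_le (by simpa using hR)] at hre
      exact hre.1)
  simp only [smul_eq_mul] at hcauchy
  have hhoriz : ∀ y : ℝ, |y| = R → ‖∫ x in ε..ε + R, G (x + y * Complex.I)‖ ≤ M * R := by
    intro y hy
    refine (intervalIntegral.norm_integral_le_of_norm_le_const (C := M) fun x hx ↦
      hM _ ?_ ?_).trans_eq (by simp [abs_of_nonneg hR])
    · rw [uIoc_of_le (by linarith)] at hx
      simpa using hx.1.le
    · simpa [hy] using Complex.abs_im_le_norm (x + y * Complex.I)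
  have hright : ‖∫ y in (-R)..R, G ((ε + R : ℝ) + y * Complex.I)‖ ≤ 2 * (M * R) := by
    refine (intervalIntegral.norm_integral_le_of_norm_le_const (C := M) fun y _ ↦
      hM _ ?_ ?_).trans_eq ?_
    · simpa using hR
    · refine le_trans ?_ (Complex.abs_re_le_norm _)
      simpa using (le_add_of_nonneg_left hε).trans (le_abs_self _)
    · rw [sub_neg_eq_add, ← two_mul, abs_of_nonneg (by positivity)]
      ring
  have hleft : ‖∫ y in (-R)..R, G (ε + y * Complex.I)‖ =
      ‖(∫ x in ε..ε + R, G (x + (-R : ℝ) * Complex.I)) -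
        (∫ x in ε..ε + R, G (x + R * Complex.I)) +
        Complex.I * ∫ y in (-R)..R, G ((ε + R : ℝ) + y * Complex.I)‖ := by
    rw [sub_eq_zero.1 hcauchy, norm_mul, Complex.norm_I, one_mul]
  rw [hleft]
  calc _ ≤ M * R + M * R + 2 * (M * R) := by
        refine (norm_add_le _ _).trans (add_le_add ((norm_sub_le _ _).trans (add_le_add ?_ ?_)) ?_)
        · exact hhoriz (-R) (by rw [abs_neg, abs_of_nonneg hR])
        · exact hhoriz R (abs_of_nonneg hR)
        · rwa [norm_mul, Complex.norm_I, one_mul]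
    _ = 4 * R * M := by ring

theorem integral_vertical_line_eq_zero {G : ℂ → ℂ} {ε δ : ℝ} (hε : 0 ≤ ε) (hδ : 0 < δ)
    (hG : DifferentiableOn ℂ G {z | ε ≤ z.re})
    (hdecay : G =O[Bornology.cobounded ℂ ⊓ 𝓟 {z | ε ≤ z.re}] fun z ↦ ‖z‖ ^ (-(1 + δ))) :
    ∫ y : ℝ, G (ε + y * Complex.I) = 0 := by
  by_cases hint : Integrable fun y : ℝ ↦ G (ε + y * Complex.I)
  swap
  · exact integral_undef hint
  refine tendsto_nhds_unique
    (intervalIntegral_tendsto_integral hint tendsto_neg_atTop_atBot tendsto_id) ?_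
  obtain ⟨C, hC, hbound⟩ := hdecay.exists_nonneg
  obtain ⟨R₀, -, hR₀⟩ := (hasBasis_cobounded_norm.eventually_iff).1
    (eventually_inf_principal.1 hbound.bound)
  have hlim : Tendsto (fun R : ℝ ↦ 4 * C * R ^ (-δ)) atTop (𝓝 0) := by
    simpa using (tendsto_rpow_neg_atTop hδ).const_mul (4 * C)
  refine squeeze_zero_norm' ?_ hlim
  filter_upwards [eventually_gt_atTop 0, eventually_ge_atTop R₀] with R hR hRR₀
  have hM : ∀ z : ℂ, ε ≤ z.re → R ≤ ‖z‖ → ‖G z‖ ≤ C * R ^ (-(1 + δ)) := by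
    intro z hz hRz
    refine (hR₀ (hRR₀.trans hRz) hz).trans (mul_le_mul_of_nonneg_left ?_ hC)
    rw [Real.norm_of_nonneg (by positivity)]
    exact Real.rpow_le_rpow_of_nonpos hR hRz (by linarith)
  calc _ ≤ 4 * R * (C * R ^ (-(1 + δ))) := norm_integral_vertical_segment_le hε hR.le hG hM
    _ = 4 * C * (R ^ (-(1 + δ)) * R) := by ring
    _ = 4 * C * R ^ (-δ) := by
      rw [← Real.rpow_add_one hR.ne']
      ring_nf

theorem setIntegral_Ioi_re_eq_zero_of_conj_symm {f : ℝ → ℂ}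
    (hf : ∀ y, f (-y) = (starRingEnd ℂ) (f y)) (hi : IntegrableOn f (Ioi 0))
    (h0 : ∫ y, f y = 0) : ∫ y in Ioi (0 : ℝ), (f y).re = 0 := by
  have hint : Integrable f := by
    refine integrable_of_integrableOn_Ioi ?_ hi
    simp_rw [hf]
    exact (Complex.conjCLE : ℂ →L[ℝ] ℂ).integrable_comp hi
  have hre : ∫ y, (f y).re = 0 := (integral_re hint).trans (by rw [h0]; rfl)
  have heven : (fun y ↦ (f y).re) = fun y ↦ (f |y|).re := by
    funext y
    rcases abs_cases y with h | h <;> rw [h.1]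
    rw [hf, Complex.conj_re]
  rw [heven, integral_comp_abs (f := fun y ↦ (f y).re)] at hre
  linarith

theorem integral_Ioi_inv_sq_add_sq {ξ : ℝ} (hξ : 0 < ξ) :
    ∫ s in Ioi (0 : ℝ), (s ^ 2 + ξ ^ 2)⁻¹ = π / (2 * ξ) := by
  have hscale := integral_comp_mul_left_Ioi (fun x : ℝ ↦ (1 + x ^ 2)⁻¹) 0 (inv_pos.2 hξ)
  rw [mul_zero, integral_Ioi_inv_one_add_sq, Real.arctan_zero, inv_inv, smul_eq_mul] at hscale
  have hfactor : ∀ s : ℝ, (s ^ 2 + ξ ^ 2)⁻¹ = (ξ ^ 2)⁻¹ * (1 + (ξ⁻¹ * s) ^ 2)⁻¹ := by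
    intro s
    rw [← mul_inv]
    congr 1
    field_simp
    ring
  simp_rw [hfactor]
  rw [integral_const_mul, hscale]
  field_simp
  ring

theorem integrableOn_Ioi_inv_sq_add_sq {ξ : ℝ} (hξ : 0 < ξ) :
    IntegrableOn (fun s : ℝ ↦ (s ^ 2 + ξ ^ 2)⁻¹) (Ioi 0) := by
  refine not_imp_comm.1 integral_undef ?_
  rw [integral_Ioi_inv_sq_add_sq hξ]
  positivity

/-- The function `(2 z F z - 2 ξ F ξ) / (z² - ξ²)`, extended holomorphically across the removable
singularity `z = ξ` by means of `dslope`. Integrating it over the imaginary axis expresses `F ξ`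
through the boundary values of `F`. -/
def stieltjesQuotient (F : ℂ → ℂ) (ξ : ℝ) (z : ℂ) : ℂ :=
  dslope (fun w ↦ 2 * w * F w) ξ z / (z + ξ)

variable {F : ℂ → ℂ} {ξ : ℝ}

theorem stieltjesQuotient_of_ne (F : ℂ → ℂ) {z : ℂ} (hz : z ≠ ξ) :
    stieltjesQuotient F ξ z = (2 * z * F z - 2 * ξ * F ξ) / (z ^ 2 - ξ ^ 2) := by
  rw [stieltjesQuotient, dslope_of_ne _ hz, slope_def_field, div_div]
  congr 1
  ring

theorem differentiableOn_stieltjesQuotient (hF : DifferentiableOn ℂ F {z | 0 < z.re})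
    (hξ : 0 < ξ) : DifferentiableOn ℂ (stieltjesQuotient F ξ) {z | 0 < z.re} := by
  have hopen : IsOpen {z : ℂ | 0 < z.re} := isOpen_lt continuous_const Complex.continuous_re
  have hnum : DifferentiableOn ℂ (fun w ↦ 2 * w * F w) {z | 0 < z.re} :=
    (differentiableOn_id.const_mul 2).mul hF
  refine ((Complex.differentiableOn_dslope (hopen.mem_nhds (by simpa using hξ))).2 hnum).div
    (by fun_prop) fun z (hz : 0 < z.re) h ↦ ?_
  have hre := congrArg Complex.re h
  rw [Complex.add_re, Complex.ofReal_re, Complex.zero_re] at hre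
  linarith

theorem stieltjesQuotient_conj
    (hconj : ∀ z : ℂ, 0 < z.re → F ((starRingEnd ℂ) z) = (starRingEnd ℂ) (F z))
    (hξ : 0 < ξ) {z : ℂ} (hz : 0 < z.re) (hzξ : z ≠ ξ) :
    stieltjesQuotient F ξ ((starRingEnd ℂ) z) = (starRingEnd ℂ) (stieltjesQuotient F ξ z) := by
  have hzξ' : (starRingEnd ℂ) z ≠ ξ := by
    rwa [Ne, ← Complex.conj_ofReal ξ, (starRingEnd ℂ).injective.eq_iff]
  have hFξ : F ξ = (starRingEnd ℂ) (F ξ) := by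
    simpa using hconj ξ (by simpa using hξ)
  rw [stieltjesQuotient_of_ne F hzξ, stieltjesQuotient_of_ne F hzξ', hconj z hz]
  simp only [map_div₀, map_sub, map_mul, map_pow, Complex.conj_ofReal, map_ofNat, ← hFξ]

theorem isBigO_stieltjesQuotient {l : Filter ℂ} (hl : l ≤ Bornology.cobounded ℂ) {δ : ℝ}
    (hδ : δ ≤ 1) (hF : F =O[l] fun z ↦ ‖z‖ ^ (-δ)) :
    stieltjesQuotient F ξ =O[l] fun z ↦ ‖z‖ ^ (-(1 + δ)) := by
  have hlarge : ∀ r : ℝ, ∀ᶠ z in l, r ≤ ‖z‖ := fun r ↦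
    hl (tendsto_norm_cobounded_atTop.eventually_ge_atTop r)
  have hmain : (fun z ↦ 2 * z * F z) =O[l] fun z ↦ ‖z‖ ^ (1 - δ) := by
    refine (((Asymptotics.isBigO_refl (fun z : ℂ ↦ z) l).norm_right.const_mul_left 2).mul
      hF).congr' .rfl ?_
    filter_upwards [hlarge 1] with z hz
    rw [sub_eq_add_neg, Real.rpow_add (by linarith), Real.rpow_one]
  have hconst : (fun _ ↦ 2 * ξ * F ξ) =O[l] fun z ↦ ‖z‖ ^ (1 - δ) := by
    refine Asymptotics.IsBigO.of_bound ‖2 * ξ * F ξ‖ ?_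
    filter_upwards [hlarge 1] with z hz
    exact le_mul_of_one_le_right (norm_nonneg _)
      ((Real.one_le_rpow hz (by linarith)).trans (Real.le_norm_self _))
  have hden : (fun z : ℂ ↦ (z ^ 2 - ξ ^ 2)⁻¹) =O[l] fun z ↦ (z ^ 2)⁻¹ := by
    have hlittle : (fun _ : ℂ ↦ (ξ : ℂ) ^ 2) =o[l] fun z ↦ z ^ 2 := by
      refine Asymptotics.isLittleO_const_left.2 (.inr ?_)
      simpa only [Function.comp_def, norm_pow] using
        (tendsto_pow_atTop two_ne_zero).comp (tendsto_norm_cobounded_atTop.mono_left hl)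
    refine hlittle.right_isBigO_sub.inv_rev ?_
    filter_upwards [hlarge 1] with z hz h
    rw [pow_eq_zero_iff two_ne_zero] at h
    norm_num [h] at hz
  refine ((hmain.sub hconst).mul hden.norm_right).congr' ?_ ?_
  · filter_upwards [hlarge (|ξ| + 1)] with z hz
    rw [stieltjesQuotient_of_ne F, div_eq_mul_inv]
    rintro rfl
    norm_num at hz
  · filter_upwards [hlarge 1] with z hz
    have hz0 : 0 < ‖z‖ := by linarith
    rw [norm_inv, norm_pow, ← Real.rpow_two, ← Real.rpow_neg hz0.le, ← Real.rpow_add hz0]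
    ring_nf

theorem sq_add_sq_le_norm_sq_sub_sq {ε s : ℝ} (hε : ε ∈ Ioc 0 (ξ / 2)) :
    s ^ 2 + (ξ / 2) ^ 2 ≤ ‖(ε + s * Complex.I) ^ 2 - (ξ : ℂ) ^ 2‖ := by
  obtain ⟨hε0, hεξ⟩ := hε
  refine le_of_sq_le_sq ?_ (norm_nonneg _)
  rw [← Complex.normSq_eq_norm_sq, sq_sub_sq, map_mul, Complex.normSq_apply, Complex.normSq_apply,
    sq (s ^ 2 + _), add_comm (s ^ 2)]
  simp only [Complex.add_re, Complex.sub_re, Complex.add_im, Complex.sub_im, Complex.ofReal_re,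
    Complex.ofReal_im, Complex.re_ofReal_mul, Complex.im_ofReal_mul,
    Complex.I_re, Complex.I_im, mul_zero, mul_one, zero_add, add_zero, sub_zero]
  gcongr <;> nlinarith

theorem norm_stieltjesQuotient_le {ε s g : ℝ} (hε : ε ∈ Ioc 0 (ξ / 2))
    (hg : ‖(ε + s * Complex.I) * F (ε + s * Complex.I)‖ ≤ (1 + s ^ 2) * g) :
    ‖stieltjesQuotient F ξ (ε + s * Complex.I)‖ ≤
      2 * (1 + ((ξ / 2) ^ 2)⁻¹) * g + ‖2 * ξ * F ξ‖ * (s ^ 2 + (ξ / 2) ^ 2)⁻¹ := by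
  have hη : 0 < ξ / 2 := hε.1.trans_le hε.2
  have hg0 : 0 ≤ g := nonneg_of_mul_nonneg_right ((norm_nonneg _).trans hg) (by positivity)
  have hne : (ε : ℂ) + s * Complex.I ≠ ξ := fun h ↦ by
    have hre : ε = ξ := by simpa using congrArg Complex.re h
    linarith [hε.2]
  have hden := sq_add_sq_le_norm_sq_sub_sq (s := s) hε
  have hcomp : 1 + s ^ 2 ≤ (1 + ((ξ / 2) ^ 2)⁻¹) * (s ^ 2 + (ξ / 2) ^ 2) := by
    generalize ξ / 2 = η at hη
    have : (1 + (η ^ 2)⁻¹) * (s ^ 2 + η ^ 2) = 1 + s ^ 2 + η ^ 2 + s ^ 2 * (η ^ 2)⁻¹ := by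
      field_simp
      ring
    rw [this, add_assoc]
    exact le_add_of_nonneg_right (by positivity)
  rw [stieltjesQuotient_of_ne F hne, norm_div, div_le_iff₀ (lt_of_lt_of_le (by positivity) hden)]
  calc _ ≤ 2 * ((1 + s ^ 2) * g) + ‖2 * ξ * F ξ‖ := by
        refine (norm_sub_le _ _).trans (add_le_add_left ?_ _)
        rw [mul_assoc, norm_mul, Complex.norm_ofNat]
        gcongr
    _ ≤ 2 * ((1 + ((ξ / 2) ^ 2)⁻¹) * (s ^ 2 + (ξ / 2) ^ 2) * g) + ‖2 * ξ * F ξ‖ := by gcongr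
    _ = (2 * (1 + ((ξ / 2) ^ 2)⁻¹) * g + ‖2 * ξ * F ξ‖ * (s ^ 2 + (ξ / 2) ^ 2)⁻¹) *
        (s ^ 2 + (ξ / 2) ^ 2) := by
      have hD : s ^ 2 + (ξ / 2) ^ 2 ≠ 0 := by positivity
      generalize s ^ 2 + (ξ / 2) ^ 2 = D at hD
      field_simp
    _ ≤ _ := by gcongr

theorem continuous_stieltjesQuotient_vertical (hF : DifferentiableOn ℂ F {z | 0 < z.re})
    (hξ : 0 < ξ) {ε : ℝ} (hε : 0 < ε) :
    Continuous fun s : ℝ ↦ stieltjesQuotient F ξ (ε + s * Complex.I) :=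
  (differentiableOn_stieltjesQuotient hF hξ).continuousOn.comp_continuous (by fun_prop)
    fun s ↦ by simpa using hε

theorem setIntegral_re_stieltjesQuotient_eq_zero (hF : DifferentiableOn ℂ F {z | 0 < z.re})
    (hconj : ∀ z : ℂ, 0 < z.re → F ((starRingEnd ℂ) z) = (starRingEnd ℂ) (F z))
    {ε δ : ℝ} (hε : ε ∈ Ioc 0 (ξ / 2)) (hδ : δ ∈ Ioc 0 1)
    (hdecay : F =O[Bornology.cobounded ℂ ⊓ 𝓟 {z | ε ≤ z.re}] fun z ↦ ‖z‖ ^ (-δ))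
    (hint : IntegrableOn (fun s : ℝ ↦ stieltjesQuotient F ξ (ε + s * Complex.I)) (Ioi 0)) :
    ∫ s in Ioi (0 : ℝ), (stieltjesQuotient F ξ (ε + s * Complex.I)).re = 0 := by
  have hξ : 0 < ξ := by linarith [hε.1, hε.2]
  refine setIntegral_Ioi_re_eq_zero_of_conj_symm
    (f := fun s : ℝ ↦ stieltjesQuotient F ξ (ε + s * Complex.I)) (fun s ↦ ?_) hint ?_
  · have hne : (ε : ℂ) + s * Complex.I ≠ ξ := by
      intro h
      have hre := congrArg Complex.re h
      simp only [Complex.add_re, Complex.ofReal_re, Complex.re_ofReal_mul, Complex.I_re, mul_zero,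
        add_zero] at hre
      linarith [hε.2]
    rw [← stieltjesQuotient_conj hconj hξ (by simpa using hε.1) hne]
    simp
  · exact integral_vertical_line_eq_zero hε.1.le hδ.1
      ((differentiableOn_stieltjesQuotient hF hξ).mono fun z hz ↦ hε.1.trans_le hz)
      (isBigO_stieltjesQuotient inf_le_left hδ.2 hdecay)

theorem tendsto_re_stieltjesQuotient {s : ℝ} (hs : 0 < s) {L : ℂ}
    (hL : Tendsto (fun ε : ℝ ↦ F (ε + s * Complex.I)) (𝓝[>] 0) (𝓝 L)) :
    Tendsto (fun ε : ℝ ↦ (stieltjesQuotient F ξ (ε + s * Complex.I)).re) (𝓝[>] 0)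
      (𝓝 ((2 * ξ * (F ξ).re + 2 * s * L.im) / (s ^ 2 + ξ ^ 2))) := by
  have hz : Tendsto (fun ε : ℝ ↦ (ε + s * Complex.I : ℂ)) (𝓝[>] 0) (𝓝 (s * Complex.I)) := by
    have hcont : ContinuousAt (fun ε : ℝ ↦ (ε + s * Complex.I : ℂ)) 0 := by fun_prop
    simpa using hcont.tendsto.mono_left (nhdsWithin_le_nhds (s := Ioi 0))
  have hden : ((s : ℂ) * Complex.I) ^ 2 - (ξ : ℂ) ^ 2 = ((-(s ^ 2 + ξ ^ 2) : ℝ) : ℂ) := by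
    rw [mul_pow, Complex.I_sq]
    push_cast
    ring
  have hden0 : ((s : ℂ) * Complex.I) ^ 2 - (ξ : ℂ) ^ 2 ≠ 0 := by
    rw [hden, Complex.ofReal_ne_zero]
    exact neg_ne_zero.2 (by positivity)
  have hlim := (Complex.continuous_re.tendsto _).comp
    ((((hz.const_mul 2).mul hL).sub_const (2 * ξ * F ξ)).div
      ((hz.pow 2).sub_const ((ξ : ℂ) ^ 2)) hden0)
  have hval : ((2 * (s * Complex.I) * L - 2 * ξ * F ξ) / ((s * Complex.I) ^ 2 - (ξ : ℂ) ^ 2)).re =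
      (2 * ξ * (F ξ).re + 2 * s * L.im) / (s ^ 2 + ξ ^ 2) := by
    rw [hden, Complex.div_ofReal_re, div_neg, ← neg_div]
    congr 1
    simp
  rw [hval] at hlim
  refine hlim.congr fun ε ↦ ?_
  rw [stieltjesQuotient_of_ne F]
  · rfl
  · exact fun h ↦ hs.ne' (by simpa using congrArg Complex.im h)

theorem setIntegral_boundary_eq_zero (hF : DifferentiableOn ℂ F {z | 0 < z.re})
    (hconj : ∀ z : ℂ, 0 < z.re → F ((starRingEnd ℂ) z) = (starRingEnd ℂ) (F z)) {δ : ℝ}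
    (hδ : δ ∈ Ioc 0 1)
    (hdecay : ∀ ε > 0, F =O[Bornology.cobounded ℂ ⊓ 𝓟 {z | ε ≤ z.re}] fun z ↦ ‖z‖ ^ (-δ))
    {g : ℝ → ℝ} (hg : IntegrableOn g (Ioi 0))
    (hdom : ∀ᶠ ε : ℝ in 𝓝[>] 0, ∀ᵐ s : ℝ ∂volume.restrict (Ioi 0),
      ‖(ε + s * Complex.I) * F (ε + s * Complex.I)‖ ≤ (1 + s ^ 2) * g s)
    {L : ℝ → ℂ} (hL : ∀ᵐ s : ℝ ∂volume.restrict (Ioi 0),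
      Tendsto (fun ε : ℝ ↦ F (ε + s * Complex.I)) (𝓝[>] 0) (𝓝 (L s))) (hξ : 0 < ξ) :
    ∫ s in Ioi (0 : ℝ), (2 * ξ * (F ξ).re + 2 * s * (L s).im) / (s ^ 2 + ξ ^ 2) = 0 := by
  set bound : ℝ → ℝ := fun s ↦
    2 * (1 + ((ξ / 2) ^ 2)⁻¹) * g s + ‖2 * ξ * F ξ‖ * (s ^ 2 + (ξ / 2) ^ 2)⁻¹
  have hbound : IntegrableOn bound (Ioi 0) :=
    (hg.const_mul _).add ((integrableOn_Ioi_inv_sq_add_sq (half_pos hξ)).const_mul _)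
  have hsmall : ∀ᶠ ε : ℝ in 𝓝[>] 0, ε ∈ Ioc 0 (ξ / 2) := Ioc_mem_nhdsGT (half_pos hξ)
  have hle : ∀ᶠ ε : ℝ in 𝓝[>] 0, ∀ᵐ s : ℝ ∂volume.restrict (Ioi 0),
      ‖stieltjesQuotient F ξ (ε + s * Complex.I)‖ ≤ bound s := by
    filter_upwards [hdom, hsmall] with ε hdomε hε
    filter_upwards [hdomε] with s hs using norm_stieltjesQuotient_le hε hs
  have hlim := tendsto_integral_filter_of_dominated_convergence (l := 𝓝[>] (0 : ℝ))
    (F := fun (ε s : ℝ) ↦ (stieltjesQuotient F ξ (ε + s * Complex.I)).re)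
    (f := fun s ↦ (2 * ξ * (F ξ).re + 2 * s * (L s).im) / (s ^ 2 + ξ ^ 2)) bound
    (by
      filter_upwards [hsmall] with ε hε
      exact (Complex.continuous_re.comp
        (continuous_stieltjesQuotient_vertical hF hξ hε.1)).aestronglyMeasurable)
    (by
      filter_upwards [hle] with ε hleε
      filter_upwards [hleε] with s hs using (Complex.abs_re_le_norm _).trans hs)
    hbound
    (by
      filter_upwards [hL, ae_restrict_mem measurableSet_Ioi] with s hs hs0
      exact tendsto_re_stieltjesQuotient hs0 hs)
  refine tendsto_nhds_unique hlim (tendsto_const_nhds.congr' ?_)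
  filter_upwards [hle, hsmall] with ε hleε hε
  exact (setIntegral_re_stieltjesQuotient_eq_zero hF hconj hε hδ (hdecay ε hε.1)
    (hbound.mono' (continuous_stieltjesQuotient_vertical hF hξ hε.1).aestronglyMeasurable
      hleε)).symm

theorem setIntegral_mul_eq_re_of_boundary (hF : DifferentiableOn ℂ F {z | 0 < z.re})
    (hconj : ∀ z : ℂ, 0 < z.re → F ((starRingEnd ℂ) z) = (starRingEnd ℂ) (F z)) {δ : ℝ}
    (hδ : δ ∈ Ioc 0 1)
    (hdecay : ∀ ε > 0, F =O[Bornology.cobounded ℂ ⊓ 𝓟 {z | ε ≤ z.re}] fun z ↦ ‖z‖ ^ (-δ))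
    {g : ℝ → ℝ} (hg : IntegrableOn g (Ioi 0))
    (hdom : ∀ᶠ ε : ℝ in 𝓝[>] 0, ∀ᵐ s : ℝ ∂volume.restrict (Ioi 0),
      ‖(ε + s * Complex.I) * F (ε + s * Complex.I)‖ ≤ (1 + s ^ 2) * g s)
    {L : ℝ → ℂ} (hL : ∀ᵐ s : ℝ ∂volume.restrict (Ioi 0),
      Tendsto (fun ε : ℝ ↦ F (ε + s * Complex.I)) (𝓝[>] 0) (𝓝 (L s)))
    {ρ : ℝ → ℝ} (hρ : ∀ᵐ s : ℝ ∂volume.restrict (Ioi 0), (L s).im = -(π * ρ s)) (hξ : 0 < ξ)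
    (hint : IntegrableOn (fun s ↦ ρ s * (2 * s / (s ^ 2 + ξ ^ 2))) (Ioi 0)) :
    ∫ s in Ioi (0 : ℝ), ρ s * (2 * s / (s ^ 2 + ξ ^ 2)) = (F ξ).re := by
  have hzero := setIntegral_boundary_eq_zero hF hconj hδ hdecay hg hdom hL hξ
  have hsplit : ∀ᵐ s : ℝ ∂volume.restrict (Ioi (0 : ℝ)),
      (2 * ξ * (F ξ).re + 2 * s * (L s).im) / (s ^ 2 + ξ ^ 2) =
        2 * ξ * (F ξ).re * (s ^ 2 + ξ ^ 2)⁻¹ - π * (ρ s * (2 * s / (s ^ 2 + ξ ^ 2))) := by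
    filter_upwards [hρ] with s hs
    rw [hs]
    ring
  rw [integral_congr_ae hsplit,
    integral_sub ((integrableOn_Ioi_inv_sq_add_sq hξ).const_mul _) (hint.const_mul π),
    integral_const_mul, integral_const_mul, integral_Ioi_inv_sq_add_sq hξ, sub_eq_zero] at hzero
  refine mul_left_cancel₀ Real.pi_ne_zero (hzero.symm.trans ?_)
  field_simp

end StieltjesRepresentation

section ComplexTanh

theorem sinh_eq_re_add_im (z : ℂ) : Complex.sinh z =
    (Real.sinh z.re * Real.cos z.im : ℝ) + (Real.cosh z.re * Real.sin z.im : ℝ) * Complex.I := by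
  conv_lhs => rw [← Complex.re_add_im z, Complex.sinh_add, Complex.cosh_mul_I, Complex.sinh_mul_I]
  push_cast
  ring

theorem cosh_eq_re_add_im (z : ℂ) : Complex.cosh z =
    (Real.cosh z.re * Real.cos z.im : ℝ) + (Real.sinh z.re * Real.sin z.im : ℝ) * Complex.I := by
  conv_lhs => rw [← Complex.re_add_im z, Complex.cosh_add, Complex.cosh_mul_I, Complex.sinh_mul_I]
  push_cast
  ring

theorem normSq_sinh (z : ℂ) :
    Complex.normSq (Complex.sinh z) = Real.sinh z.re ^ 2 + Real.sin z.im ^ 2 := by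
  rw [sinh_eq_re_add_im, Complex.normSq_add_mul_I]
  linear_combination (Real.sin z.im ^ 2) * Real.cosh_sq z.re +
    (Real.sinh z.re ^ 2) * Real.sin_sq_add_cos_sq z.im

theorem normSq_cosh (z : ℂ) :
    Complex.normSq (Complex.cosh z) = Real.sinh z.re ^ 2 + Real.cos z.im ^ 2 := by
  rw [cosh_eq_re_add_im, Complex.normSq_add_mul_I]
  linear_combination (Real.cos z.im ^ 2) * Real.cosh_sq z.re +
    (Real.sinh z.re ^ 2) * Real.sin_sq_add_cos_sq z.im

theorem cosh_ne_zero_of_re_pos {z : ℂ} (hz : 0 < z.re) : Complex.cosh z ≠ 0 := by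
  rw [← Complex.normSq_pos, normSq_cosh]
  have := Real.sinh_pos_iff.2 hz
  positivity

theorem sinh_mul_conj_cosh (z : ℂ) : Complex.sinh z * (starRingEnd ℂ) (Complex.cosh z) =
    (Real.sinh z.re * Real.cosh z.re : ℝ) + (Real.sin z.im * Real.cos z.im : ℝ) * Complex.I := by
  rw [sinh_eq_re_add_im, cosh_eq_re_add_im]
  apply Complex.ext
  · simp only [Complex.mul_re, Complex.mul_im, Complex.add_re, Complex.add_im, Complex.conj_re,
      Complex.conj_im, Complex.ofReal_re, Complex.ofReal_im, Complex.I_re, Complex.I_im]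
    linear_combination (Real.sinh z.re * Real.cosh z.re) * Real.sin_sq_add_cos_sq z.im
  · simp only [Complex.mul_re, Complex.mul_im, Complex.add_re, Complex.add_im, Complex.conj_re,
      Complex.conj_im, Complex.ofReal_re, Complex.ofReal_im, Complex.I_re, Complex.I_im]
    linear_combination (Real.sin z.im * Real.cos z.im) * Real.cosh_sq z.re

theorem tanh_div_self_eq (z : ℂ) : Complex.tanh z / z =
    ((Complex.normSq (Complex.cosh z * z))⁻¹ : ℝ) *
      (((Real.sinh z.re * Real.cosh z.re : ℝ) + (Real.sin z.im * Real.cos z.im : ℝ) * Complex.I) *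
        (starRingEnd ℂ) z) := by
  rw [← sinh_mul_conj_cosh, Complex.tanh_eq_sinh_div_cosh, div_div, div_eq_mul_inv, Complex.inv_def,
    map_mul]
  ring

theorem lt_sinh_mul_cosh {x : ℝ} (hx : 0 < x) : x < Real.sinh x * Real.cosh x := by
  nlinarith [Real.self_lt_sinh_iff.2 hx, Real.one_le_cosh x]

theorem sin_mul_cos_lt {y : ℝ} (hy : 0 < y) : Real.sin y * Real.cos y < y := by
  have h := Real.sin_lt (x := 2 * y) (by positivity)
  rw [Real.sin_two_mul] at h
  linarith

theorem tanh_div_self_im_neg {z : ℂ} (hre : 0 < z.re) (him : 0 < z.im) :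
    (Complex.tanh z / z).im < 0 := by
  have hz : 0 < Complex.normSq (Complex.cosh z * z) :=
    Complex.normSq_pos.2 (mul_ne_zero (cosh_ne_zero_of_re_pos hre) (Complex.ne_zero_of_re_pos hre))
  rw [tanh_div_self_eq, Complex.im_ofReal_mul]
  refine mul_neg_of_pos_of_neg (inv_pos.2 hz) ?_
  simp only [Complex.mul_re, Complex.mul_im, Complex.add_re, Complex.add_im, Complex.conj_re,
    Complex.conj_im, Complex.ofReal_re, Complex.ofReal_im, Complex.I_re, Complex.I_im]
  nlinarith [lt_sinh_mul_cosh hre, sin_mul_cos_lt him]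

theorem tanh_div_self_pos {x : ℝ} (hx : x ≠ 0) : 0 < Real.tanh x / x := by
  rw [Real.tanh_eq_sinh_div_cosh, div_right_comm]
  refine div_pos ?_ (Real.cosh_pos x)
  rcases hx.lt_or_gt with h | h
  · exact div_pos_of_neg_of_neg (Real.sinh_neg_iff.2 h) h
  · exact div_pos (Real.sinh_pos_iff.2 h) h

theorem tanh_div_self_mem_slitPlane {z : ℂ} (hz : 0 < z.re) :
    Complex.tanh z / z ∈ Complex.slitPlane := by
  rcases lt_trichotomy z.im 0 with him | him | him
  · have h := tanh_div_self_im_neg (z := (starRingEnd ℂ) z) (by simpa using hz) (by simpa using him)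
    rw [Complex.tanh_conj, ← map_div₀, Complex.conj_im, neg_lt_zero] at h
    exact Or.inr h.ne'
  · lift z to ℝ using him
    rw [← Complex.ofReal_tanh, ← Complex.ofReal_div, Complex.ofReal_mem_slitPlane]
    exact tanh_div_self_pos hz.ne'
  · exact Or.inr (tanh_div_self_im_neg hz him).ne

theorem normSq_tanh (z : ℂ) : Complex.normSq (Complex.tanh z) =
    (Real.sinh z.re ^ 2 + Real.sin z.im ^ 2) / (Real.sinh z.re ^ 2 + Real.cos z.im ^ 2) := by
  rw [Complex.tanh_eq_sinh_div_cosh, map_div₀, normSq_sinh, normSq_cosh]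

theorem norm_tanh_le_of_le_re {ε : ℝ} (hε : 0 < ε) {z : ℂ} (hz : ε ≤ z.re) :
    ‖Complex.tanh z‖ ≤ √(1 + (Real.sinh ε ^ 2)⁻¹) := by
  have hsinh : 0 < Real.sinh ε := Real.sinh_pos_iff.2 hε
  have hle : Real.sinh ε ^ 2 ≤ Real.sinh z.re ^ 2 + Real.cos z.im ^ 2 :=
    le_add_of_le_of_nonneg (by gcongr; exact Real.sinh_le_sinh.2 hz) (sq_nonneg _)
  have hden : 0 < Real.sinh z.re ^ 2 + Real.cos z.im ^ 2 := (pow_pos hsinh 2).trans_le hle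
  refine Real.le_sqrt_of_sq_le ?_
  calc ‖Complex.tanh z‖ ^ 2
      = (Real.sinh z.re ^ 2 + Real.sin z.im ^ 2) / (Real.sinh z.re ^ 2 + Real.cos z.im ^ 2) := by
        rw [← Complex.normSq_eq_norm_sq, normSq_tanh]
    _ ≤ (Real.sinh z.re ^ 2 + Real.cos z.im ^ 2 + 1) /
          (Real.sinh z.re ^ 2 + Real.cos z.im ^ 2) := by
        gcongr
        · exact le_add_of_nonneg_right (sq_nonneg _)
        · exact Real.sin_sq_le_one _
    _ = 1 + (Real.sinh z.re ^ 2 + Real.cos z.im ^ 2)⁻¹ := by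
        rw [add_div, div_self hden.ne', one_div]
    _ ≤ 1 + (Real.sinh ε ^ 2)⁻¹ := by gcongr

theorem norm_tanh_le_of_abs_re_le {a : ℝ} {z : ℂ} (hre : |z.re| ≤ a) (hcos : Real.cos z.im ≠ 0) :
    ‖Complex.tanh z‖ ≤ Real.cosh a * |Real.cos z.im|⁻¹ := by
  have hsinh : Real.sinh z.re ^ 2 ≤ Real.sinh a ^ 2 := by
    rw [sq_le_sq, Real.abs_sinh, Real.abs_sinh, Real.sinh_le_sinh]
    exact hre.trans (le_abs_self a)
  have := Real.cosh_pos a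
  refine le_of_sq_le_sq ?_ (by positivity)
  rw [← Complex.normSq_eq_norm_sq, normSq_tanh, mul_pow, inv_pow, sq_abs, Real.cosh_sq,
    ← div_eq_mul_inv]
  have : 0 < Real.cos z.im ^ 2 := by positivity
  gcongr
  · exact Real.sin_sq_le_one z.im
  · exact le_add_of_nonneg_left (sq_nonneg _)

end ComplexTanh

section BoundaryPower

theorem continuousWithinAt_cpow_ofReal {α : ℝ} (hα : 0 < α) (x : ℝ) :
    ContinuousWithinAt (fun w : ℂ ↦ w ^ (α : ℂ)) {w | 0 ≤ w.im} (x : ℂ) := by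
  rcases lt_or_ge x 0 with hx | hx
  · have hlog : ContinuousWithinAt (fun w : ℂ ↦ Complex.exp (Complex.log w * α)) {w | 0 ≤ w.im} x :=
      ((Complex.continuousWithinAt_log_of_re_neg_of_im_zero hx (Complex.ofReal_im x)).mul_const
        _).cexp
    have hx0 : (x : ℂ) ≠ 0 := Complex.ofReal_ne_zero.2 hx.ne
    refine hlog.congr_of_eventuallyEq ?_ (Complex.cpow_def_of_ne_zero hx0 _)
    filter_upwards [mem_nhdsWithin_of_mem_nhds (isOpen_ne.mem_nhds hx0)] with w hw
      using Complex.cpow_def_of_ne_zero hw _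
  · have hpow : ContinuousAt (fun p : ℂ × ℂ ↦ p.1 ^ p.2) ((x : ℂ), (α : ℂ)) :=
      Complex.continuousAt_cpow_of_re_pos (Or.inl hx) hα
    exact (hpow.comp (f := fun w : ℂ ↦ (w, (α : ℂ))) (by fun_prop)).continuousWithinAt

theorem tendsto_cpow_nhdsWithin_im_neg {α : ℝ} (hα : 0 < α) (x : ℝ) :
    Tendsto (fun w : ℂ ↦ w ^ (α : ℂ)) (𝓝[{w | w.im < 0}] (x : ℂ))
      (𝓝 ((starRingEnd ℂ) ((x : ℂ) ^ (α : ℂ)))) := by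
  have hconj : Tendsto (starRingEnd ℂ) (𝓝[{w | w.im < 0}] (x : ℂ)) (𝓝[{w | 0 ≤ w.im}] (x : ℂ)) := by
    refine tendsto_nhdsWithin_iff.2 ⟨?_, ?_⟩
    · simpa using (Complex.continuous_conj.tendsto (x : ℂ)).mono_left nhdsWithin_le_nhds
    · filter_upwards [self_mem_nhdsWithin] with w hw
      simpa using (show w.im < 0 from hw).le
  refine ((Complex.continuous_conj.tendsto _).comp
    ((continuousWithinAt_cpow_ofReal hα x).tendsto.comp hconj)).congr' ?_
  filter_upwards [self_mem_nhdsWithin] with w hw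
  have harg : w.arg ≠ π := fun h ↦ hw.ne (Complex.arg_eq_pi_iff.1 h).2
  simp only [Function.comp_apply, Complex.conj_cpow _ _ harg, Complex.conj_ofReal,
    Complex.conj_conj]

end BoundaryPower

section TanhSymbol

/-- The holomorphic extension of `tanhSymbol α` to the right half-plane. -/
def complexTanhSymbol (α : ℝ) (z : ℂ) : ℂ := (Complex.tanh z / z) ^ (α : ℂ)

theorem complexTanhSymbol_ofReal (α : ℝ) {ξ : ℝ} (hξ : ξ ≠ 0) :
    complexTanhSymbol α ξ = (tanhSymbol α ξ : ℂ) := by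
  rw [complexTanhSymbol, tanhSymbol, if_neg hξ, Complex.ofReal_cpow (tanh_div_self_pos hξ).le,
    Complex.ofReal_div, Complex.ofReal_tanh]

theorem complexTanhSymbol_conj (α : ℝ) {z : ℂ} (hz : 0 < z.re) :
    complexTanhSymbol α ((starRingEnd ℂ) z) = (starRingEnd ℂ) (complexTanhSymbol α z) := by
  rw [complexTanhSymbol, complexTanhSymbol, Complex.tanh_conj, ← map_div₀, Complex.conj_cpow _ _
    (Complex.slitPlane_arg_ne_pi (tanh_div_self_mem_slitPlane hz)), Complex.conj_ofReal]

theorem differentiableOn_complexTanhSymbol (α : ℝ) :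
    DifferentiableOn ℂ (complexTanhSymbol α) {z | 0 < z.re} := by
  intro z hz
  have htanh : DifferentiableAt ℂ (fun w ↦ Complex.tanh w / w) z := by
    simp only [Complex.tanh_eq_sinh_div_cosh]
    exact (Complex.differentiableAt_sinh.div Complex.differentiableAt_cosh
      (cosh_ne_zero_of_re_pos hz)).div differentiableAt_id (Complex.ne_zero_of_re_pos hz)
  exact (htanh.cpow_const (tanh_div_self_mem_slitPlane hz)).differentiableWithinAt

theorem norm_complexTanhSymbol (α : ℝ) (z : ℂ) :
    ‖complexTanhSymbol α z‖ = (‖Complex.tanh z‖ / ‖z‖) ^ α := by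
  rw [complexTanhSymbol, Complex.norm_cpow_real, norm_div]

theorem isBigO_complexTanhSymbol {α ε : ℝ} (hα : 0 ≤ α) (hε : 0 < ε) :
    complexTanhSymbol α =O[Bornology.cobounded ℂ ⊓ 𝓟 {z | ε ≤ z.re}] fun z ↦ ‖z‖ ^ (-α) := by
  refine Asymptotics.IsBigO.of_bound (√(1 + (Real.sinh ε ^ 2)⁻¹) ^ α) ?_
  filter_upwards [mem_inf_of_right (mem_principal_self _)] with z hz
  rw [norm_complexTanhSymbol, Real.norm_of_nonneg (by positivity),
    Real.div_rpow (norm_nonneg _) (norm_nonneg _), Real.rpow_neg (norm_nonneg _), div_eq_mul_inv]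
  gcongr
  exact norm_tanh_le_of_le_re hε hz

theorem norm_mul_complexTanhSymbol_le {α : ℝ} (hα : α ∈ Icc 0 1) {z : ℂ} (hz : z ≠ 0)
    (hre : |z.re| ≤ 1) (hcos : Real.cos z.im ≠ 0) :
    ‖z * complexTanhSymbol α z‖ ≤
      (1 + z.im ^ 2) *
        (2 * Real.cosh 1 ^ α * (|Real.cos z.im| ^ (-α) * (1 + |z.im|) ^ (-(1 + α)))) := by
  have hcosh := Real.cosh_pos 1
  have hnorm : 0 < ‖z‖ := norm_pos_iff.2 hz
  have hle : ‖z‖ ≤ 1 + |z.im| := (Complex.norm_le_abs_re_add_abs_im z).trans (by gcongr)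
  calc ‖z * complexTanhSymbol α z‖
      = ‖Complex.tanh z‖ ^ α * ‖z‖ ^ (1 - α) := by
        rw [norm_mul, norm_complexTanhSymbol, Real.div_rpow (norm_nonneg _) hnorm.le,
          Real.rpow_sub hnorm, Real.rpow_one]
        ring
    _ ≤ (Real.cosh 1 * |Real.cos z.im|⁻¹) ^ α * (1 + |z.im|) ^ (1 - α) := by
        gcongr
        · exact hα.1
        · exact norm_tanh_le_of_abs_re_le hre hcos
        · exact sub_nonneg.2 hα.2
    _ = (1 + |z.im|) ^ 2 *
          (Real.cosh 1 ^ α * (|Real.cos z.im| ^ (-α) * (1 + |z.im|) ^ (-(1 + α)))) := by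
        rw [Real.mul_rpow hcosh.le (by positivity), Real.inv_rpow (abs_nonneg _),
          Real.rpow_neg (abs_nonneg _), show 1 - α = (2 : ℕ) + -(1 + α) by push_cast; ring,
          Real.rpow_add (by positivity), Real.rpow_natCast]
        ring
    _ ≤ (2 * (1 + z.im ^ 2)) *
          (Real.cosh 1 ^ α * (|Real.cos z.im| ^ (-α) * (1 + |z.im|) ^ (-(1 + α)))) := by
        gcongr
        nlinarith [sq_nonneg (1 - |z.im|), sq_abs z.im]
    _ = _ := by ring

theorem tendsto_tanh_div_self_vertical {s : ℝ} (hs : 0 < s) (hcos : Real.cos s ≠ 0) :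
    Tendsto (fun ε : ℝ ↦ Complex.tanh (ε + s * Complex.I) / (ε + s * Complex.I)) (𝓝[>] 0)
      (𝓝[{w | w.im < 0}] ((Real.tan s / s : ℝ) : ℂ)) := by
  have hcosh : Complex.cosh (s * Complex.I) ≠ 0 := by
    rw [Complex.cosh_mul_I, ← Complex.ofReal_cos]
    exact Complex.ofReal_ne_zero.2 hcos
  have hcont : ContinuousAt
      (fun ε : ℝ ↦ Complex.tanh (ε + s * Complex.I) / (ε + s * Complex.I)) 0 := by
    simp only [Complex.tanh_eq_sinh_div_cosh]
    refine ContinuousAt.div (ContinuousAt.div ?_ ?_ (by simpa using hcosh)) ?_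
      (by simpa using hs.ne')
    all_goals fun_prop
  have hval : Complex.tanh ((0 : ℝ) + s * Complex.I) / ((0 : ℝ) + s * Complex.I) =
      ((Real.tan s / s : ℝ) : ℂ) := by
    rw [Complex.ofReal_zero, zero_add, Complex.tanh_mul_I, mul_div_mul_right _ _ Complex.I_ne_zero,
      Complex.ofReal_div, Complex.ofReal_tan]
  refine tendsto_nhdsWithin_iff.2 ⟨hval ▸ hcont.tendsto.mono_left nhdsWithin_le_nhds, ?_⟩
  filter_upwards [self_mem_nhdsWithin] with ε hε
  exact tanh_div_self_im_neg (by simpa using hε) (by simpa using hs)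

theorem tendsto_complexTanhSymbol_vertical {α s : ℝ} (hα : 0 < α) (hs : 0 < s)
    (hcos : Real.cos s ≠ 0) :
    Tendsto (fun ε : ℝ ↦ complexTanhSymbol α (ε + s * Complex.I)) (𝓝[>] 0)
      (𝓝 ((starRingEnd ℂ) (((Real.tan s / s : ℝ) : ℂ) ^ (α : ℂ)))) :=
  (tendsto_cpow_nhdsWithin_im_neg hα _).comp (tendsto_tanh_div_self_vertical hs hcos)

end TanhSymbol

section PeriodicMulAntitone

theorem iUnion_Ioc_natCast_mul {T : ℝ} (hT : 0 < T) :
    ⋃ n : ℕ, Ioc (n * T) ((Order.succ n : ℕ) * T) = Ioi 0 := by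
  rw [iUnion_Ioc_map_succ_eq_Ioi (f := fun n : ℕ ↦ (n : ℝ) * T)]
  · simp
  · intro n
    simp only [bot_eq_zero', Nat.cast_zero, zero_mul]
    positivity
  · exact not_bddAbove_of_tendsto_atTop (tendsto_natCast_atTop_atTop.atTop_mul_const hT)

theorem norm_mul_le_of_antitoneOn {g φ : ℝ → ℝ} {a b s : ℝ} (ha : 0 ≤ a)
    (hφ : AntitoneOn φ (Ici 0)) (hφ_nonneg : ∀ s, 0 ≤ s → 0 ≤ φ s) (hs : s ∈ Ioc a b) :
    ‖g s * φ s‖ ≤ ‖g s‖ * φ a := by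
  have hs0 : 0 ≤ s := ha.trans hs.1.le
  rw [norm_mul, Real.norm_of_nonneg (hφ_nonneg s hs0)]
  exact mul_le_mul_of_nonneg_left (hφ ha hs0 hs.1.le) (norm_nonneg _)

theorem integrableOn_Ioi_periodic_mul_antitone {g φ : ℝ → ℝ} {T : ℝ} (hT : 0 < T)
    (hg : Function.Periodic g T) (hgi : IntervalIntegrable g volume 0 T)
    (hφ : AntitoneOn φ (Ici 0)) (hφ_nonneg : ∀ s, 0 ≤ s → 0 ≤ φ s)
    (hsum : Summable fun n : ℕ ↦ φ (n * T)) :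
    IntegrableOn (fun s ↦ g s * φ s) (Ioi 0) := by
  have hstart (n : ℕ) : 0 ≤ n * T := by positivity
  have hend (n : ℕ) : (Order.succ n : ℕ) * T = n * T + T := by
    rw [Nat.succ_eq_succ, Nat.cast_succ]
    ring
  have hg_period (n : ℕ) : IntegrableOn g (Ioc (n * T) ((Order.succ n : ℕ) * T)) := by
    rw [hend]
    exact (intervalIntegrable_iff_integrableOn_Ioc_of_le (by linarith)).1
      (hg.intervalIntegrable₀ hT.ne' hgi _ _)
  have hle (n : ℕ) : ∀ s ∈ Ioc (n * T) ((Order.succ n : ℕ) * T),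
      ‖g s * φ s‖ ≤ ‖g s‖ * φ (n * T) :=
    fun s ↦ norm_mul_le_of_antitoneOn (hstart n) hφ hφ_nonneg
  have hmul (n : ℕ) : IntegrableOn (fun s ↦ g s * φ s) (Ioc (n * T) ((Order.succ n : ℕ) * T)) := by
    refine ((hg_period n).norm.mul_const (φ (n * T))).mono'
      ((hg_period n).aestronglyMeasurable.mul ?_)
      ((ae_restrict_mem measurableSet_Ioc).mono (hle n))
    refine (aemeasurable_restrict_of_antitoneOn measurableSet_Ioc
      (hφ.mono fun s hs ↦ ?_)).aestronglyMeasurable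
    exact (hstart n).trans hs.1.le
  rw [← iUnion_Ioc_natCast_mul hT]
  refine integrableOn_iUnion_of_summable_integral_norm hmul ?_
  refine (hsum.mul_left (∫ s in (0 : ℝ)..0 + T, ‖g s‖)).of_nonneg_of_le
    (fun n ↦ integral_nonneg fun _ ↦ norm_nonneg _) fun n ↦ ?_
  have hnorm : Function.Periodic (fun s ↦ ‖g s‖) T := hg.comp norm
  rw [hnorm.intervalIntegral_add_eq 0 (n * T), intervalIntegral.integral_of_le (by linarith),
    ← hend, ← integral_mul_const]
  exact setIntegral_mono_on (hmul n).norm ((hg_period n).norm.mul_const _) measurableSet_Ioc (hle n)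

theorem intervalIntegrable_abs_sub_rpow {r : ℝ} (hr : -1 < r) (c a b : ℝ) :
    IntervalIntegrable (fun x : ℝ ↦ |c - x| ^ r) volume a b := by
  have hzero (b : ℝ) : IntervalIntegrable (fun x : ℝ ↦ |x| ^ r) volume 0 b :=
    intervalIntegrable_of_even (by simp) fun x hx ↦
      (intervalIntegral.intervalIntegrable_rpow' hr).congr fun y hy ↦ by
        rw [uIoc_of_le hx.le] at hy
        simp only [abs_of_pos hy.1]
  simpa using ((hzero (c - a)).symm.trans (hzero (c - b))).comp_sub_left c

theorem mul_abs_pi_div_two_sub_le_abs_cos {x : ℝ} (hx : x ∈ Icc 0 π) :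
    2 / π * |π / 2 - x| ≤ |Real.cos x| := by
  rw [← Real.sin_pi_div_two_sub]
  refine Real.mul_abs_le_abs_sin (abs_le.2 ⟨?_, ?_⟩) <;> linarith [hx.1, hx.2]

theorem intervalIntegrable_abs_cos_rpow {r : ℝ} (hr : -1 < r) :
    IntervalIntegrable (fun s ↦ |Real.cos s| ^ r) volume 0 π := by
  rcases le_or_gt 0 r with hr0 | hr0
  · exact (Real.continuous_cos.abs.rpow_const fun _ ↦ Or.inr hr0).intervalIntegrable 0 π
  refine ((intervalIntegrable_abs_sub_rpow hr (π / 2) 0 π).const_mul ((2 / π) ^ r)).mono_fun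
    (Measurable.aestronglyMeasurable (by fun_prop)) ?_
  rw [uIoc_of_le Real.pi_pos.le]
  filter_upwards [ae_restrict_mem measurableSet_Ioc,
    ae_restrict_of_ae (Measure.ae_ne volume (π / 2))] with x hx hne
  have : 0 < |π / 2 - x| := abs_pos.2 (sub_ne_zero.2 hne.symm)
  have := Real.pi_pos
  rw [Real.norm_of_nonneg (by positivity), Real.norm_of_nonneg (by positivity),
    ← Real.mul_rpow (by positivity) (by positivity)]
  exact Real.rpow_le_rpow_of_nonpos (by positivity)
    (mul_abs_pi_div_two_sub_le_abs_cos (Ioc_subset_Icc_self hx)) hr0.le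

theorem integrableOn_abs_cos_rpow_mul_one_add_rpow {r γ : ℝ} (hr : -1 < r) (hγ : 1 < γ) :
    IntegrableOn (fun s : ℝ ↦ |Real.cos s| ^ r * (1 + s) ^ (-γ)) (Ioi 0) := by
  refine integrableOn_Ioi_periodic_mul_antitone Real.pi_pos (fun s ↦ by simp [Real.cos_add_pi])
    (intervalIntegrable_abs_cos_rpow hr) (fun s hs t _ hst ↦ ?_) (fun s hs ↦ by positivity) ?_
  · exact Real.rpow_le_rpow_of_nonpos (by linarith [mem_Ici.1 hs]) (by linarith) (by linarith)
  · have hsum : Summable fun n : ℕ ↦ ((n + 1 : ℕ) : ℝ) ^ (-γ) :=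
      (summable_nat_add_iff 1).2 (Real.summable_nat_rpow.2 (by linarith))
    refine hsum.of_nonneg_of_le (fun n ↦ by positivity) fun n ↦ ?_
    refine Real.rpow_le_rpow_of_nonpos (by positivity) ?_ (by linarith)
    push_cast
    nlinarith [Real.pi_gt_three, (n.cast_nonneg : (0 : ℝ) ≤ n)]

theorem ae_cos_ne_zero : ∀ᵐ s : ℝ, Real.cos s ≠ 0 := by
  have hrange : {s : ℝ | Real.cos s = 0} = range fun k : ℤ ↦ (2 * (k : ℝ) + 1) * π / 2 := by
    ext s
    exact Real.cos_eq_zero_iff.trans (exists_congr fun k ↦ eq_comm)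
  exact (hrange ▸ countable_range _ : {s : ℝ | Real.cos s = 0}.Countable).ae_notMem volume

end PeriodicMulAntitone

section TanhMeasure

/-- The density of the Stieltjes representation of `tanhSymbol α`: up to the factor `-π`, the
imaginary part of the boundary values of `complexTanhSymbol α` on the imaginary axis, where
`tanh z / z` takes the real values `tan s / s`. -/
def tanhDensity (α s : ℝ) : ℝ := (((Real.tan s / s : ℝ) : ℂ) ^ (α : ℂ)).im / π

theorem measurable_tanhDensity (α : ℝ) : Measurable (tanhDensity α) := by
  have htan : Measurable Real.tan := by
    rw [funext Real.tan_eq_sin_div_cos]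
    fun_prop
  unfold tanhDensity
  fun_prop

theorem tanhDensity_nonneg {α : ℝ} (hα : α ∈ Icc 0 1) (s : ℝ) : 0 ≤ tanhDensity α s := by
  rw [tanhDensity, Complex.cpow_ofReal_im]
  have harg : 0 ≤ ((Real.tan s / s : ℝ) : ℂ).arg := Complex.arg_nonneg_iff.2 (by simp)
  have hsin : 0 ≤ Real.sin (((Real.tan s / s : ℝ) : ℂ).arg * α) :=
    Real.sin_nonneg_of_nonneg_of_le_pi (mul_nonneg harg hα.1)
      ((mul_le_of_le_one_right harg hα.2).trans (Complex.arg_le_pi _))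
  positivity

theorem tanhDensity_eq_zero (α : ℝ) {s : ℝ} (hs : s ∈ Icc 0 (π / 2)) : tanhDensity α s = 0 := by
  have h : 0 ≤ Real.tan s / s :=
    div_nonneg (Real.tan_nonneg_of_nonneg_of_le_pi_div_two hs.1 hs.2) hs.1
  rw [tanhDensity, ← Complex.ofReal_cpow h, Complex.ofReal_im, zero_div]

theorem tanhDensity_le {α s : ℝ} (hα : 0 ≤ α) (hs : 0 < s) :
    tanhDensity α s ≤ |Real.cos s| ^ (-α) * s ^ (-α) := by
  have htan : |Real.tan s| ≤ |Real.cos s|⁻¹ := by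
    rw [Real.tan_eq_sin_div_cos, abs_div, div_eq_mul_inv]
    exact mul_le_of_le_one_left (by positivity) (Real.abs_sin_le_one s)
  calc tanhDensity α s
      ≤ |Real.tan s / s| ^ α / π := by
        rw [tanhDensity, Complex.cpow_ofReal_im, Complex.norm_real, Real.norm_eq_abs]
        gcongr
        exact mul_le_of_le_one_right (by positivity) (Real.sin_le_one _)
    _ ≤ |Real.tan s / s| ^ α := div_le_self (by positivity) (by linarith [Real.pi_gt_three])
    _ ≤ (|Real.cos s|⁻¹ * s⁻¹) ^ α := by
        rw [abs_div, abs_of_pos hs, div_eq_mul_inv]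
        gcongr
    _ = |Real.cos s| ^ (-α) * s ^ (-α) := by
        rw [Real.mul_rpow (by positivity) (by positivity), Real.inv_rpow (abs_nonneg _),
          Real.inv_rpow hs.le, Real.rpow_neg (abs_nonneg _), Real.rpow_neg hs.le]

theorem tanhDensity_mul_rpow_le {α β s : ℝ} (hα : 0 ≤ α) (hαβ : 0 ≤ α + β) (hs : 0 < s) :
    tanhDensity α s * s ^ (-β) ≤
      2 ^ (α + β) * (|Real.cos s| ^ (-α) * (1 + s) ^ (-(α + β))) := by
  rcases le_or_gt s (π / 2) with hs' | hs'
  · rw [tanhDensity_eq_zero α ⟨hs.le, hs'⟩, zero_mul]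
    positivity
  have hs1 : 1 < s := by linarith [Real.pi_gt_three]
  have htwo : s ^ (-(α + β)) ≤ 2 ^ (α + β) * (1 + s) ^ (-(α + β)) := by
    rw [Real.rpow_neg hs.le, ← Real.inv_rpow hs.le, Real.rpow_neg (by positivity),
      ← Real.inv_rpow (by positivity), ← Real.mul_rpow (by positivity) (by positivity)]
    gcongr
    rw [← div_eq_mul_inv, le_div_iff₀ (by positivity), inv_mul_le_iff₀ hs]
    linarith
  calc tanhDensity α s * s ^ (-β)
      ≤ |Real.cos s| ^ (-α) * s ^ (-α) * s ^ (-β) := by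
        gcongr
        exact tanhDensity_le hα hs
    _ = |Real.cos s| ^ (-α) * s ^ (-(α + β)) := by
        rw [mul_assoc, ← Real.rpow_add hs, neg_add]
    _ ≤ |Real.cos s| ^ (-α) * (2 ^ (α + β) * (1 + s) ^ (-(α + β))) := by gcongr
    _ = _ := by ring

theorem integrableOn_tanhDensity_mul_rpow {α β : ℝ} (hα : α ∈ Ico 0 1) (hβ : 1 - α < β) :
    IntegrableOn (fun s ↦ tanhDensity α s * s ^ (-β)) (Ioi 0) := by
  refine ((integrableOn_abs_cos_rpow_mul_one_add_rpow (r := -α) (γ := α + β)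
    (by linarith [hα.2]) (by linarith)).const_mul (2 ^ (α + β))).mono'
    ((measurable_tanhDensity α).mul (by fun_prop)).aestronglyMeasurable ?_
  filter_upwards [ae_restrict_mem measurableSet_Ioi] with s hs
  have hs : 0 < s := hs
  rw [Real.norm_of_nonneg
    (mul_nonneg (tanhDensity_nonneg (Ico_subset_Icc_self hα) s) (by positivity))]
  exact tanhDensity_mul_rpow_le hα.1 (by linarith) hs

theorem two_mul_div_sq_add_sq_le_two_mul_inv {s : ℝ} (hs : 0 < s) (ξ : ℝ) :
    2 * s / (s ^ 2 + ξ ^ 2) ≤ 2 * s⁻¹ := by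
  rw [div_le_iff₀ (by positivity), mul_assoc, mul_add, pow_two, inv_mul_cancel_left₀ hs.ne']
  nlinarith [mul_nonneg (inv_pos.2 hs).le (sq_nonneg ξ)]

theorem integrableOn_tanhDensity_mul_div {α : ℝ} (hα : α ∈ Ioo 0 1) (ξ : ℝ) :
    IntegrableOn (fun s ↦ tanhDensity α s * (2 * s / (s ^ 2 + ξ ^ 2))) (Ioi 0) := by
  refine ((integrableOn_tanhDensity_mul_rpow (Ioo_subset_Ico_self hα) (β := 1)
    (by linarith [hα.1])).const_mul 2).mono'
    ((measurable_tanhDensity α).mul (by fun_prop)).aestronglyMeasurable ?_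
  filter_upwards [ae_restrict_mem measurableSet_Ioi] with s hs
  have hs : 0 < s := hs
  have hnonneg := tanhDensity_nonneg (Ioo_subset_Icc_self hα) s
  rw [Real.norm_of_nonneg (by positivity), Real.rpow_neg_one, mul_left_comm]
  exact mul_le_mul_of_nonneg_left (two_mul_div_sq_add_sq_le_two_mul_inv hs ξ) hnonneg

theorem setIntegral_tanhDensity_mul_div {α ξ : ℝ} (hα : α ∈ Ioo 0 1) (hξ : 0 < ξ) :
    ∫ s in Ioi 0, tanhDensity α s * (2 * s / (s ^ 2 + ξ ^ 2)) = tanhSymbol α ξ := by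
  rw [← Complex.ofReal_re (tanhSymbol α ξ), ← complexTanhSymbol_ofReal α hξ.ne']
  have hcos : ∀ᵐ s : ℝ ∂volume.restrict (Ioi 0), 0 < s ∧ Real.cos s ≠ 0 := by
    filter_upwards [ae_restrict_mem measurableSet_Ioi, ae_restrict_of_ae ae_cos_ne_zero]
      with s hs hcos using ⟨hs, hcos⟩
  refine setIntegral_mul_eq_re_of_boundary (differentiableOn_complexTanhSymbol α)
    (fun z hz ↦ complexTanhSymbol_conj α hz) (Ioo_subset_Ioc_self hα)
    (fun ε hε ↦ isBigO_complexTanhSymbol hα.1.le hε)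
    ((integrableOn_abs_cos_rpow_mul_one_add_rpow (r := -α) (γ := 1 + α) (by linarith [hα.2])
      (by linarith [hα.1])).const_mul (2 * Real.cosh 1 ^ α)) ?_
    (hcos.mono fun s hs ↦ tendsto_complexTanhSymbol_vertical hα.1 hs.1 hs.2)
    (.of_forall fun s ↦ ?_) hξ (integrableOn_tanhDensity_mul_div hα ξ)
  · filter_upwards [Ioo_mem_nhdsGT one_pos] with ε hε
    filter_upwards [hcos] with s ⟨hs, hcos⟩
    have hre : ((ε : ℂ) + s * Complex.I).re = ε := by simp
    have him : ((ε : ℂ) + s * Complex.I).im = s := by simp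
    have hbound := norm_mul_complexTanhSymbol_le (Ioo_subset_Icc_self hα)
      (Complex.ne_zero_of_re_pos (hre ▸ hε.1)) (by rw [hre, abs_of_pos hε.1]; exact hε.2.le)
      (him.symm ▸ hcos)
    rwa [him, abs_of_pos hs] at hbound
  · rw [tanhDensity, Complex.conj_im, mul_div_cancel₀ _ Real.pi_ne_zero]

/-- The measure representing `tanhSymbol α` as a Stieltjes function of `ξ ^ 2`; see
`integral_two_mul_div_tanhMeasure`. -/
def tanhMeasure (α : ℝ) : Measure ℝ :=
  (volume.restrict (Ioi 0)).withDensity fun s ↦ ENNReal.ofReal (tanhDensity α s)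

instance (α : ℝ) : SFinite (tanhMeasure α) := by
  unfold tanhMeasure
  infer_instance

theorem ae_tanhMeasure_pos (α : ℝ) : ∀ᵐ s ∂tanhMeasure α, 0 < s :=
  (withDensity_absolutelyContinuous _ _).ae_le (ae_restrict_mem measurableSet_Ioi)

theorem integrable_tanhMeasure_iff {α : ℝ} (hα : α ∈ Icc 0 1) {f : ℝ → ℝ} :
    Integrable f (tanhMeasure α) ↔ IntegrableOn (fun s ↦ tanhDensity α s * f s) (Ioi 0) := by
  rw [tanhMeasure, integrable_withDensity_iff_integrable_smul'
    (measurable_tanhDensity α).ennreal_ofReal (by simp)]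
  simp only [ENNReal.toReal_ofReal (tanhDensity_nonneg hα _), smul_eq_mul, IntegrableOn]

theorem integral_tanhMeasure {α : ℝ} (hα : α ∈ Icc 0 1) (f : ℝ → ℝ) :
    ∫ s, f s ∂tanhMeasure α = ∫ s in Ioi 0, tanhDensity α s * f s := by
  rw [tanhMeasure, integral_withDensity_eq_integral_toReal_smul
    (measurable_tanhDensity α).ennreal_ofReal (by simp)]
  simp only [ENNReal.toReal_ofReal (tanhDensity_nonneg hα _), smul_eq_mul]

theorem integrable_rpow_neg_tanhMeasure {α β : ℝ} (hα : α ∈ Ico 0 1) (hβ : 1 - α < β) :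
    Integrable (fun s ↦ s ^ (-β)) (tanhMeasure α) :=
  (integrable_tanhMeasure_iff (Ico_subset_Icc_self hα)).2 (integrableOn_tanhDensity_mul_rpow hα hβ)

theorem integrable_inv_tanhMeasure {α : ℝ} (hα : α ∈ Ioo 0 1) :
    Integrable (fun s ↦ s⁻¹) (tanhMeasure α) := by
  simpa only [Real.rpow_neg_one] using
    integrable_rpow_neg_tanhMeasure (Ioo_subset_Ico_self hα) (β := 1) (by linarith [hα.1])

theorem continuous_integral_two_mul_div {μ : Measure ℝ} (hμ : ∀ᵐ s ∂μ, 0 < s)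
    (hi : Integrable (fun s ↦ s⁻¹) μ) :
    Continuous fun ξ : ℝ ↦ ∫ s, 2 * s / (s ^ 2 + ξ ^ 2) ∂μ := by
  refine continuous_of_dominated (bound := fun s ↦ 2 * s⁻¹)
    (fun ξ ↦ Measurable.aestronglyMeasurable (by fun_prop)) (fun ξ ↦ ?_) (hi.const_mul 2) ?_
  · filter_upwards [hμ] with s hs
    rw [Real.norm_of_nonneg (by positivity)]
    exact two_mul_div_sq_add_sq_le_two_mul_inv hs ξ
  · filter_upwards [hμ] with s hs
    exact continuous_const.div (by fun_prop) fun ξ ↦ by positivity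

theorem tanhSymbol_zero (α : ℝ) : tanhSymbol α 0 = 1 := if_pos rfl

theorem tanhSymbol_neg (α ξ : ℝ) : tanhSymbol α (-ξ) = tanhSymbol α ξ := by
  simp [tanhSymbol, Real.tanh_neg, neg_div_neg_eq]

theorem tendsto_tanhSymbol_zero (α : ℝ) : Tendsto (tanhSymbol α) (𝓝[≠] 0) (𝓝 1) := by
  have htanh : HasDerivAt Real.tanh 1 0 := by
    rw [show Real.tanh = Real.sinh / Real.cosh from funext Real.tanh_eq_sinh_div_cosh]
    simpa using (Real.hasDerivAt_sinh 0).div (Real.hasDerivAt_cosh 0) (Real.cosh_pos 0).ne'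
  have hpow := (hasDerivAt_iff_tendsto_slope.1 htanh).rpow_const (p := α) (Or.inl one_ne_zero)
  rw [Real.one_rpow] at hpow
  refine hpow.congr' ?_
  filter_upwards [self_mem_nhdsWithin] with ξ hξ
  simp [tanhSymbol, show ξ ≠ 0 from hξ, slope_def_field]

theorem integral_two_mul_div_tanhMeasure {α : ℝ} (hα : α ∈ Ioo 0 1) (ξ : ℝ) :
    ∫ s, 2 * s / (s ^ 2 + ξ ^ 2) ∂tanhMeasure α = tanhSymbol α ξ := by
  have hpos {ξ : ℝ} (hξ : 0 < ξ) :
      ∫ s, 2 * s / (s ^ 2 + ξ ^ 2) ∂tanhMeasure α = tanhSymbol α ξ := by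
    rw [integral_tanhMeasure (Ioo_subset_Icc_self hα), setIntegral_tanhDensity_mul_div hα hξ]
  rcases lt_trichotomy ξ 0 with hξ | rfl | hξ
  · rw [← tanhSymbol_neg, ← hpos (neg_pos.2 hξ), neg_sq]
  · have hcont := (continuous_integral_two_mul_div (ae_tanhMeasure_pos α)
      (integrable_inv_tanhMeasure hα)).tendsto 0
    rw [tanhSymbol_zero]
    refine tendsto_nhds_unique ((hcont.mono_left nhdsWithin_le_nhds).congr' ?_)
      ((tendsto_tanhSymbol_zero α).mono_left (nhdsGT_le_nhdsNE 0))
    filter_upwards [self_mem_nhdsWithin] with ξ hξ using hpos hξ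
  · exact hpos hξ

theorem tanhMeasure_ne_zero {α : ℝ} (hα : α ∈ Ioo 0 1) : tanhMeasure α ≠ 0 := by
  intro h
  have hone := integral_two_mul_div_tanhMeasure hα 0
  rw [h, integral_zero_measure, tanhSymbol_zero] at hone
  exact zero_ne_one hone

end TanhMeasure

section TemperedDistributions

theorem integrable_prod_cexp_mul_schwartzMap_mul {f : ℝ → ℂ} (hf : Integrable f) (φ : 𝓢(ℝ, ℂ)) :
    Integrable (Function.uncurry fun x ξ : ℝ ↦ φ x * f ξ * Complex.exp (-Complex.I * x * ξ))
      (volume.prod volume) := by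
  refine (φ.integrable.mul_prod hf).mul_bdd (c := 1)
    (Measurable.aestronglyMeasurable (by fun_prop)) (.of_forall fun z ↦ ?_)
  simp [Complex.norm_exp]

theorem integral_cexp_mul_schwartzMap_mul {f : ℝ → ℂ} (φ : 𝓢(ℝ, ℂ)) (x : ℝ) :
    ∫ ξ : ℝ, φ x * f ξ * Complex.exp (-Complex.I * x * ξ) =
      φ x * ∫ ξ : ℝ, f ξ * Complex.exp (-Complex.I * ξ * x) := by
  rw [← integral_const_mul]
  congr with ξ
  rw [mul_assoc, mul_right_comm _ (ξ : ℂ)]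

theorem integrable_schwartzMap_mul_integral {f : ℝ → ℂ} (hf : Integrable f) (φ : 𝓢(ℝ, ℂ)) :
    Integrable fun x : ℝ ↦ φ x * ∫ ξ : ℝ, f ξ * Complex.exp (-Complex.I * ξ * x) := by
  simpa only [Function.uncurry_apply_pair, integral_cexp_mul_schwartzMap_mul] using
    (integrable_prod_cexp_mul_schwartzMap_mul hf φ).integral_prod_left

theorem integral_angularFourierSchwartz_mul {f : ℝ → ℂ} (hf : Integrable f) (φ : 𝓢(ℝ, ℂ)) :
    ∫ ξ : ℝ, angularFourierSchwartz φ ξ * f ξ =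
      ∫ x : ℝ, φ x * ∫ ξ : ℝ, f ξ * Complex.exp (-Complex.I * ξ * x) := by
  simp only [← integral_cexp_mul_schwartzMap_mul]
  rw [integral_integral_swap (integrable_prod_cexp_mul_schwartzMap_mul hf φ)]
  simp only [angularFourierSchwartz_apply, mul_right_comm _ (f _), integral_mul_const]

theorem exists_isGivenBy_angularFourier {f m : ℝ → ℝ} (hf : Integrable f)
    (hm : ∀ ξ : ℝ, ∫ x : ℝ, (f x : ℂ) * Complex.exp (-Complex.I * x * ξ) = m ξ) :
    ∃ T : 𝓢'(ℝ, ℂ), IsGivenBy T f ∧ IsGivenBy (angularFourier T) m := by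
  have hf' : Integrable fun x ↦ (f x : ℂ) := hf.ofReal
  have hL : MemLp (fun x ↦ (f x : ℂ)) 1 := memLp_one_iff_integrable.2 hf'
  have hT (φ : 𝓢(ℝ, ℂ)) : Lp.toTemperedDistribution hL.toLp φ = ∫ x, φ x * (f x : ℂ) := by
    rw [Lp.toTemperedDistribution_apply]
    refine integral_congr_ae ?_
    filter_upwards [hL.coeFn_toLp] with x hx
    rw [hx, smul_eq_mul]
  refine ⟨Lp.toTemperedDistribution hL.toLp, fun φ ↦ ⟨?_, hT φ⟩, fun φ ↦ ⟨?_, ?_⟩⟩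
  · exact hf'.bdd_mul φ.continuous.aestronglyMeasurable
      (.of_forall fun x ↦ φ.norm_le_seminorm ℝ x)
  · simpa only [hm] using integrable_schwartzMap_mul_integral hf' φ
  · rw [angularFourier_apply, hT, integral_angularFourierSchwartz_mul hf']
    simp only [hm]

theorem angularFourierSchwartz_surjective : Function.Surjective angularFourierSchwartz := by
  intro ψ
  refine ⟨FourierTransformInv.fourierInv
    (SchwartzMap.compCLMOfContinuousLinearEquiv ℂ frequencyScaling.symm ψ), ?_⟩
  rw [angularFourierSchwartz, ContinuousLinearMap.comp_apply, FourierTransform.fourierCLM_apply,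
    FourierInvPair.fourier_fourierInv_eq]
  ext x
  simp

theorem eq_of_isGivenBy_angularFourier {T S : 𝓢'(ℝ, ℂ)} {m : ℝ → ℝ}
    (hT : IsGivenBy (angularFourier T) m) (hS : IsGivenBy (angularFourier S) m) : T = S := by
  ext ψ
  obtain ⟨φ, rfl⟩ := angularFourierSchwartz_surjective ψ
  rw [← angularFourier_apply, ← angularFourier_apply, (hT φ).2, (hS φ).2]

theorem IsGivenBy.locallyIntegrable {T : 𝓢'(ℝ, ℂ)} {f : ℝ → ℝ} (hT : IsGivenBy T f) :
    LocallyIntegrable f := by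
  rw [locallyIntegrable_iff]
  intro k hk
  obtain ⟨R, hR⟩ := hk.isBounded.subset_closedBall 0
  let b : ContDiffBump (0 : ℝ) := ⟨|R| + 1, |R| + 2, by positivity, by linarith⟩
  have hsupp : HasCompactSupport fun x ↦ (b x : ℂ) :=
    b.hasCompactSupport.comp_left Complex.ofReal_zero
  have hdiff : ContDiff ℝ ∞ fun x ↦ (b x : ℂ) := Complex.ofRealCLM.contDiff.comp b.contDiff
  refine (hT (hsupp.toSchwartzMap hdiff)).1.re.integrableOn.congr_fun (fun x hx ↦ ?_)
    hk.measurableSet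
  have hone : b x = 1 := b.one_of_mem_closedBall
    (Metric.closedBall_subset_closedBall ((le_abs_self R).trans (by simp [b])) (hR hx))
  simp [hone]

theorem IsGivenBy.ae_eq {T : 𝓢'(ℝ, ℂ)} {f g : ℝ → ℝ} (hf : IsGivenBy T f) (hg : IsGivenBy T g) :
    f =ᵐ[volume] g := by
  refine ae_eq_of_integral_contDiff_smul_eq hf.locallyIntegrable hg.locallyIntegrable ?_
  intro u hu hc
  have hsupp : HasCompactSupport fun x ↦ (u x : ℂ) := hc.comp_left Complex.ofReal_zero
  have hdiff : ContDiff ℝ ∞ fun x ↦ (u x : ℂ) := Complex.ofRealCLM.contDiff.comp hu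
  have hcast (v : ℝ → ℝ) :
      ∫ x, (hsupp.toSchwartzMap hdiff) x * (v x : ℂ) = ((∫ x, u x • v x : ℝ) : ℂ) := by
    rw [← integral_complex_ofReal]
    simp
  have heq := (hf (hsupp.toSchwartzMap hdiff)).2.symm.trans (hg (hsupp.toSchwartzMap hdiff)).2
  rw [hcast, hcast] at heq
  exact Complex.ofReal_injective heq

theorem IsTanhKernel.ae_eq {α : ℝ} {K K' : ℝ → ℝ} (hK : IsTanhKernel α K)
    (hK' : IsTanhKernel α K') : K =ᵐ[volume] K' := by
  obtain ⟨T, hT, hT'⟩ := hK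
  obtain ⟨S, hS, hS'⟩ := hK'
  obtain rfl := eq_of_isGivenBy_angularFourier hT' hS'
  exact hT.ae_eq hS

end TemperedDistributions

section TanhKernel

/-- The convolution kernel with symbol `(tanh ξ / ξ) ^ α`, as the Laplace transform of the jump of
the analytically continued symbol across the imaginary axis. -/
def tanhKernel (α : ℝ) : ℝ → ℝ := laplaceKernel (tanhMeasure α)

variable {α : ℝ}

theorem integrable_exp_neg_mul_tanhMeasure (hα : α ∈ Ioo (0 : ℝ) 1) {x : ℝ} (hx : 0 < x) :
    Integrable (fun s ↦ Real.exp (-(s * x))) (tanhMeasure α) :=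
  integrable_exp_neg_mul (ae_tanhMeasure_pos α) one_pos
    (integrable_rpow_neg_tanhMeasure ⟨hα.1.le, hα.2⟩ (by linarith [hα.1])) hx

theorem tanhKernel_pos (hα : α ∈ Ioo (0 : ℝ) 1) {x : ℝ} (hx : x ≠ 0) : 0 < tanhKernel α x :=
  have : NeZero (tanhMeasure α) := ⟨tanhMeasure_ne_zero hα⟩
  laplaceKernel_pos (fun _ ↦ integrable_exp_neg_mul_tanhMeasure hα) hx

theorem strictAntiOn_tanhKernel (hα : α ∈ Ioo (0 : ℝ) 1) :
    StrictAntiOn (tanhKernel α) (Ioi 0) :=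
  have : NeZero (tanhMeasure α) := ⟨tanhMeasure_ne_zero hα⟩
  strictAntiOn_laplaceKernel (ae_tanhMeasure_pos α) fun _ ↦ integrable_exp_neg_mul_tanhMeasure hα

theorem strictConvexOn_tanhKernel (hα : α ∈ Ioo (0 : ℝ) 1) :
    StrictConvexOn ℝ (Ioi 0) (tanhKernel α) ∧ StrictConvexOn ℝ (Iio 0) (tanhKernel α) :=
  have : NeZero (tanhMeasure α) := ⟨tanhMeasure_ne_zero hα⟩
  have hexp (x : ℝ) (hx : 0 < x) := integrable_exp_neg_mul_tanhMeasure hα hx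
  ⟨strictConvexOn_laplaceKernel_Ioi (ae_tanhMeasure_pos α) hexp,
    strictConvexOn_laplaceKernel_Iio (ae_tanhMeasure_pos α) hexp⟩

theorem contDiffOn_tanhKernel (hα : α ∈ Ioo (0 : ℝ) 1) : ContDiffOn ℝ ∞ (tanhKernel α) {0}ᶜ :=
  contDiffOn_laplaceKernel fun _ ↦ integrable_exp_neg_mul_tanhMeasure hα

theorem exists_norm_tanhKernel_le_mul_rpow (hα : α ∈ Ioo (0 : ℝ) 1) {β : ℝ} (hβ : 1 - α < β) :
    ∃ C : ℝ, 0 < C ∧ ∀ x : ℝ, 0 < x → ‖tanhKernel α x‖ ≤ C * x ^ (-β) := by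
  have hle (x : ℝ) (hx : 0 < x) := laplaceKernel_le_mul_rpow (ae_tanhMeasure_pos α)
    (by linarith [hα.2]) (integrable_rpow_neg_tanhMeasure ⟨hα.1.le, hα.2⟩ hβ) hx
  refine ⟨β ^ β * ∫ s, s ^ (-β) ∂tanhMeasure α, ?_, fun x hx ↦ ?_⟩
  · simpa using (tanhKernel_pos hα one_ne_zero).trans_le (hle 1 one_pos)
  · rw [Real.norm_of_nonneg (tanhKernel_pos hα hx.ne').le]
    exact hle x hx

theorem integrable_tanhKernel (hα : α ∈ Ioo (0 : ℝ) 1) : Integrable (tanhKernel α) :=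
  integrable_laplaceKernel (ae_tanhMeasure_pos α) (integrable_inv_tanhMeasure hα)

theorem integral_tanhKernel_mul_cexp (hα : α ∈ Ioo (0 : ℝ) 1) (ξ : ℝ) :
    ∫ x : ℝ, (tanhKernel α x : ℂ) * Complex.exp (-Complex.I * x * ξ) = tanhSymbol α ξ := by
  rw [← integral_two_mul_div_tanhMeasure hα]
  exact integral_laplaceKernel_mul_cexp (ae_tanhMeasure_pos α) (integrable_inv_tanhMeasure hα) ξ

theorem isTanhKernel_tanhKernel (hα : α ∈ Ioo (0 : ℝ) 1) : IsTanhKernel α (tanhKernel α) :=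
  exists_isGivenBy_angularFourier (integrable_tanhKernel hα) (integral_tanhKernel_mul_cexp hα)

theorem integral_tanhKernel (hα : α ∈ Ioo (0 : ℝ) 1) : ∫ x, tanhKernel α x = 1 := by
  have h := integral_tanhKernel_mul_cexp hα 0
  simp only [Complex.ofReal_zero, mul_zero, Complex.exp_zero, mul_one, tanhSymbol_zero] at h
  rwa [integral_complex_ofReal, Complex.ofReal_inj] at h

theorem eLpNorm_one_tanhKernel (hα : α ∈ Ioo (0 : ℝ) 1) : eLpNorm (tanhKernel α) 1 = 1 := by
  rw [eLpNorm_one_eq_lintegral_enorm, ← lintegral_ofReal_eq_one (integrable_tanhKernel hα)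
    (fun x ↦ laplaceKernel_nonneg x) (integral_tanhKernel hα)]
  exact lintegral_congr fun x ↦ Real.enorm_of_nonneg (laplaceKernel_nonneg x)

theorem tanh_one_pos : 0 < Real.tanh 1 := by
  simpa using tanh_div_self_pos one_ne_zero

theorem monotone_tanh : Monotone Real.tanh := by
  intro x y hxy
  have hsub : 0 ≤ Real.sinh (y - x) := Real.sinh_nonneg_iff.2 (sub_nonneg.2 hxy)
  rw [Real.sinh_sub] at hsub
  rw [Real.tanh_eq_sinh_div_cosh, Real.tanh_eq_sinh_div_cosh,
    div_le_div_iff₀ (Real.cosh_pos x) (Real.cosh_pos y)]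
  linarith

theorem rpow_mul_rpow_neg_le_tanhSymbol (hα : 0 ≤ α) {ξ : ℝ} (hξ : 1 ≤ ξ) :
    Real.tanh 1 ^ α * ξ ^ (-α) ≤ tanhSymbol α ξ := by
  have hpos : 0 < ξ := by linarith
  have htanh : Real.tanh 1 ≤ Real.tanh ξ := monotone_tanh hξ
  rw [tanhSymbol, if_neg hpos.ne', Real.div_rpow (tanh_one_pos.le.trans htanh) hpos.le,
    Real.rpow_neg hpos.le, ← div_eq_mul_inv]
  have := tanh_one_pos.le
  gcongr

theorem mul_rpow_le_setIntegral_tanhKernel (hα : α ∈ Ioo (0 : ℝ) 1) {x : ℝ}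
    (hx : x ∈ Ioc (0 : ℝ) 1) :
    Real.tanh 1 ^ α / 4 * x ^ α ≤ ∫ t in Ioc 0 x, tanhKernel α t := by
  have hsymbol := rpow_mul_rpow_neg_le_tanhSymbol hα.1.le ((one_le_inv₀ hx.1).2 hx.2)
  have hle := integral_two_mul_div_le_setIntegral_laplaceKernel (ae_tanhMeasure_pos α)
    (integrable_inv_tanhMeasure hα) (inv_pos.2 hx.1)
  rw [integral_two_mul_div_tanhMeasure hα, inv_inv] at hle
  rw [Real.rpow_neg_eq_inv_rpow, inv_inv] at hsymbol
  rw [tanhKernel]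
  linarith

theorem memLp_tanhKernel_of_lt (hα : α ∈ Ioo (0 : ℝ) 1) {p : ℝ≥0∞} (hp : p ≠ 0)
    (hlt : p < ENNReal.ofReal (1 / (1 - α))) : MemLp (tanhKernel α) p := by
  have hp_top : p ≠ ⊤ := hlt.ne_top
  have hp_pos : 0 < p.toReal := ENNReal.toReal_pos hp hp_top
  have hcrit : 1 - α < 1 / p.toReal := by
    rw [ENNReal.lt_ofReal_iff_toReal_lt hp_top] at hlt
    rwa [lt_one_div (sub_pos.2 hα.2) hp_pos]
  obtain ⟨a, hαa, hap⟩ := exists_between hcrit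
  obtain ⟨C, -, hC⟩ := exists_norm_tanhKernel_le_mul_rpow hα hαa
  obtain ⟨D, -, hD⟩ := exists_norm_tanhKernel_le_mul_rpow hα (hcrit.trans (lt_add_one _))
  refine memLp_of_even_of_norm_le_mul_rpow measurable_laplaceKernel.aestronglyMeasurable
    laplaceKernel_neg hp hp_top ((lt_div_iff₀ hp_pos).1 hap) ?_ hC hD
  rw [add_mul, one_div_mul_cancel hp_pos.ne', one_mul]
  exact lt_add_of_pos_right 1 hp_pos

theorem memLp_tanhKernel_iff (hα : α ∈ Ioo (0 : ℝ) 1) {p : ℝ≥0∞} (hp : p ≠ 0) :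
    MemLp (tanhKernel α) p ↔ p < ENNReal.ofReal (1 / (1 - α)) := by
  refine ⟨fun h ↦ ?_, memLp_tanhKernel_of_lt hα hp⟩
  have hc : 0 < Real.tanh 1 ^ α / 4 := div_pos (Real.rpow_pos_of_pos tanh_one_pos α) four_pos
  exact lt_of_memLp_of_mul_rpow_le_setIntegral hα hc
    (fun _ ↦ mul_rpow_le_setIntegral_tanhKernel hα) h

theorem isBellShaped_tanhKernel (hα : α ∈ Ioo (0 : ℝ) 1) {p : ℝ≥0∞} (hp : 1 ≤ p)
    (hlt : p < ENNReal.ofReal (1 / (1 - α))) : IsBellShaped p (tanhKernel α) :=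
  isBellShaped_of_antitoneOn laplaceKernel_neg (contDiffOn_tanhKernel hα).continuousOn
    (fun _ ↦ tanhKernel_pos hα) (strictAntiOn_tanhKernel hα).antitoneOn hp hlt.ne_top
    (memLp_tanhKernel_of_lt hα (one_pos.trans_le hp).ne' hlt)

theorem isLeast_isConvolutionBound_tanhKernel (hα : α ∈ Ioo (0 : ℝ) 1) {p : ℝ≥0∞} (hp : 1 ≤ p) :
    IsLeast {C : ℝ≥0∞ | IsConvolutionBound (tanhKernel α) p C} 1 :=
  isLeast_isConvolutionBound measurable_laplaceKernel (integrable_tanhKernel hα)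
    (fun x ↦ laplaceKernel_nonneg x) (integral_tanhKernel hα) hp

end TanhKernel

end

theorem mainTheorem9 (α : ℝ) (hα : α ∈ Ioo (0 : ℝ) 1) :
    ∃ K : ℝ → ℝ,
      -- `K` is the kernel with the given symbol, unique up to null sets
      (IsTanhKernel α K ∧ ∀ K' : ℝ → ℝ, IsTanhKernel α K' → K' =ᵐ[volume] K) ∧
      -- (i) smoothness away from the origin and rapid decay
      (ContDiffOn ℝ ∞ K {0}ᶜ ∧
        ∀ N : ℝ, 1 ≤ N → ∃ C : ℝ, 0 < C ∧ ∀ x : ℝ, 0 < x → |K x| ≤ C * x ^ (-N)) ∧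
      -- (ii) bell-shape, in `L^p` and pointwise away from the origin, and strict convexity
      ((∀ p : ℝ≥0∞, 1 ≤ p → p < ENNReal.ofReal (1 / (1 - α)) → IsBellShaped p K) ∧
        (∀ x : ℝ, K (-x) = K x) ∧ (∀ x : ℝ, x ≠ 0 → 0 < K x) ∧ StrictAntiOn K (Ioi 0) ∧
        StrictConvexOn ℝ (Ioi 0) K ∧ StrictConvexOn ℝ (Iio 0) K) ∧
      -- (iii) unit norm
      (eLpNorm K 1 = 1 ∧ (∫ x : ℝ, K x) = tanhSymbol α 0 ∧ tanhSymbol α 0 = 1 ∧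
        ∀ p : ℝ≥0∞, 1 ≤ p → IsLeast {C : ℝ≥0∞ | IsConvolutionBound K p C} 1) ∧
      -- (iv) integrability
      (∀ p : ℝ≥0∞, 0 < p → (MemLp K p ↔ p < ENNReal.ofReal (1 / (1 - α)))) := by
  have hint := integral_tanhKernel hα
  refine ⟨tanhKernel α,
    ⟨isTanhKernel_tanhKernel hα, fun K' hK' ↦ hK'.ae_eq (isTanhKernel_tanhKernel hα)⟩,
    ⟨contDiffOn_tanhKernel hα, fun N hN ↦ ?_⟩,
    ⟨fun p ↦ isBellShaped_tanhKernel hα, laplaceKernel_neg, fun x ↦ tanhKernel_pos hα,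
      strictAntiOn_tanhKernel hα, strictConvexOn_tanhKernel hα⟩,
    ⟨eLpNorm_one_tanhKernel hα, hint.trans (tanhSymbol_zero α).symm, tanhSymbol_zero α,
      fun p ↦ isLeast_isConvolutionBound_tanhKernel hα⟩,
    fun p hp ↦ memLp_tanhKernel_iff hα hp.ne'⟩
  exact exists_norm_tanhKernel_le_mul_rpow hα (by linarith [hα.1])
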